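/- **Theorem (Wegner estimate).** Let $d\ge 1$ and let $\Gamma$ be the cubic lattice graph in $\mathbb R^d$: its vertices are the points of $\mathbb Z^d$, and its edges $E=E(\Gamma)$ are the segments of length one joining neighbouring vertices $v$ and $v+e_k$; each edge is identified with $[0,1]$, oriented in the direction of the increasing coordinate. Let $\mu$ be a probability measure on $\mathbb R$ with $\operatorname{supp}\mu=[q_-,q_+]$ that is Hölder continuous with exponent $\alpha>0$, i.e. there is a constant $K$ with $\mu([a,b])\le K(b-a)^\alpha$ for all $a\le b$, and let $\mathbb P=\bigotimes_{e\in E}\mu$ be the law of the coupling constants $\omega=(\omega_e)_{e\in E}$. For $i\in\mathbb Z^d$ and $l>0$ let $\Lambda=\Lambda_l(i)=\{x\in\mathbb R^d: |x_k-i_k|<l/2,\ k=1,\dots,d\}$, with volume $|\Lambda|=l^d$. Call the box $\Lambda$ *$\Gamma$-edge bounded* if every edge of $\Gamma$ either is contained in $\partial\Lambda$ or meets $\partial\Lambda$ at most in its endpoints. Let $E(\Gamma\cap\Lambda)$ be the finite set of edges that run inside $\Lambda$ (edges outside $\Lambda$ and edges in $\partial\Lambda$ are deleted). Let $H^N_\Lambda(\omega)$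 be the self-adjoint operator on $\bigoplus_{e\in E(\Gamma\cap\Lambda)}L_2(0,1)$ associated with the form $$\mathfrak h^N_{\Lambda,\omega}(f,g)=\sum_{e\in E(\Gamma\cap\Lambda)}\bigl[(f_e'\mid g_e')_{L_2(0,1)}+\omega_e\,(f_e\mid g_e)_{L_2(0,1)}\bigr],$$ whose domain $W_2^1(\Gamma\cap\Lambda)$ consists of the $f=(f_e)$ with $f_e\in W_2^1(0,1)$ for all $e$ that are continuous at all vertices. Then for each $R>0$ there exists a constant $C_R$ such that for all $\Gamma$-edge bounded boxes $\Lambda=\Lambda_l(i)$, $i\in\mathbb Z^d$, $l>0$, and all intervals $I\subset(-R,R)$ of length $|I|$, $$\mathbb P\{\omega:\ \sigma(H^N_\Lambda(\omega))\cap I\neq\emptyset\}\ \le\ C_R\,|\Lambda|^2\,|I|^\alpha .$$ -/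

import Mathlib

open MeasureTheory Set
open scoped InnerProductSpace

/-! ## Spectrum of an unbounded operator; the operator associated with a form -/

section Operators

variable {H : Type*} [NormedAddCommGroup H] [InnerProductSpace ℂ H]

/-- `z` lies in the resolvent set of the (unbounded) operator `T` if `T - z`, as a map from
the domain of `T` to `H`, is a bijection whose inverse `R` is bounded. -/
def unboundedResolventSet (T : H →ₗ.[ℂ] H) : Set ℂ :=
  {z | ∃ R : H →L[ℂ] H,
    (∀ f : H, ∃ h : R f ∈ T.domain, T ⟨R f, h⟩ - z • R f = f) ∧
    (∀ u : T.domain, R (T u - z • (u : H)) = u)}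

/-- The spectrum of an unbounded operator. -/
def unboundedSpectrum (T : H →ₗ.[ℂ] H) : Set ℂ := (unboundedResolventSet T)ᶜ

/-- For a sesquilinear form `a` with form domain `D`: the `u ∈ D` such that
`a(v, u) = ⟪v, f⟫` for some `f ∈ H` and all `v ∈ D`.  (Mathlib's convention: forms and inner
products are conjugate-linear in the first argument and linear in the second one.) -/
def formOperatorDomain (D : Submodule ℂ H) (a : D →ₗ⋆[ℂ] D →ₗ[ℂ] ℂ) : Submodule ℂ H where
  carrier := {u | ∃ hu : u ∈ D, ∃ f : H, ∀ v : D, a v ⟨u, hu⟩ = ⟪(v : H), f⟫_ℂ}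
  zero_mem' := ⟨D.zero_mem, 0, fun v => by
    have : (⟨0, D.zero_mem⟩ : D) = 0 := rfl
    simp [this]⟩
  add_mem' := by
    rintro u w ⟨hu, f, hf⟩ ⟨hw, g, hg⟩
    refine ⟨D.add_mem hu hw, f + g, fun v => ?_⟩
    rw [inner_add_right, ← hf v, ← hg v, ← map_add]
    rfl
  smul_mem' := by
    rintro c u ⟨hu, f, hf⟩
    refine ⟨D.smul_mem c hu, c • f, fun v => ?_⟩
    rw [inner_smul_right, ← hf v, ← smul_eq_mul, ← map_smul]
    rfl

theorem eq_of_inner_eq_of_dense {D : Submodule ℂ H} (hD : Dense (D : Set H)) {f g : H}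
    (h : ∀ v : D, ⟪(v : H), f⟫_ℂ = ⟪(v : H), g⟫_ℂ) : f = g :=
  hD.eq_of_inner_right ℂ fun v hv => h ⟨v, hv⟩

/-- The operator associated with a densely defined sesquilinear form `a` on `D`: `u` is in its
domain and is mapped to `f` iff `u ∈ D` and `a(v, u) = ⟪v, f⟫` for all `v ∈ D`. -/
noncomputable def formOperator (D : Submodule ℂ H) (hD : Dense (D : Set H))
    (a : D →ₗ⋆[ℂ] D →ₗ[ℂ] ℂ) : H →ₗ.[ℂ] H where
  domain := formOperatorDomain D a
  toFun :=
    { toFun := fun u => u.2.choose_spec.choose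
      map_add' := fun u w => by
        refine eq_of_inner_eq_of_dense hD fun v => ?_
        rw [inner_add_right, ← u.2.choose_spec.choose_spec v, ← w.2.choose_spec.choose_spec v,
          ← (u + w).2.choose_spec.choose_spec v, ← map_add]
        rfl
      map_smul' := fun c u => by
        refine eq_of_inner_eq_of_dense hD fun v => ?_
        rw [RingHom.id_apply, inner_smul_right, ← u.2.choose_spec.choose_spec v,
          ← (c • u).2.choose_spec.choose_spec v, ← smul_eq_mul, ← map_smul]
        rfl }

theorem formOperator_apply_eq_iff (D : Submodule ℂ H) (hD : Dense (D : Set H))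
    (a : D →ₗ⋆[ℂ] D →ₗ[ℂ] ℂ) (u f : H) :
    (∃ h : u ∈ (formOperator D hD a).domain, formOperator D hD a ⟨u, h⟩ = f) ↔
      ∃ hu : u ∈ D, ∀ v : D, a v ⟨u, hu⟩ = ⟪(v : H), f⟫_ℂ := by
  constructor
  · rintro ⟨h, rfl⟩
    exact ⟨h.choose, h.choose_spec.choose_spec⟩
  · rintro ⟨hu, hf⟩
    have h : u ∈ (formOperator D hD a).domain := ⟨hu, f, hf⟩
    refine ⟨h, eq_of_inner_eq_of_dense hD fun v => ?_⟩
    rw [← hf v]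
    exact (h.choose_spec.choose_spec v).symm

end Operators

/-! ## Sobolev functions of order one on the interval `(0,1)` -/

/-- The Hilbert space `L₂(0,1)`. -/
abbrev L2Interval : Type := Lp ℂ 2 ((volume : Measure ℝ).restrict (Ioo (0 : ℝ) 1))

/-- `f ∈ L₂(0,1)` has the absolutely continuous representative `x ↦ a + ∫₀ˣ g` on `[0,1]`
with `g ∈ L₂(0,1)`; that is, `f ∈ W₂¹(0,1)`, `f' = g` and `f(0) = a`
(and therefore `f(1) = a + ∫₀¹ g`). -/
def IsPrimitive (a : ℂ) (g f : L2Interval) : Prop :=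
  ∀ᵐ x ∂((volume : Measure ℝ).restrict (Ioo (0 : ℝ) 1)), f x = a + ∫ t in (0 : ℝ)..x, g t

section Interval

theorem L2Interval.intervalIntegrable (g : L2Interval) {x : ℝ} (hx : x ∈ Icc (0 : ℝ) 1) :
    IntervalIntegrable g volume 0 x := by
  have h1 : Integrable g ((volume : Measure ℝ).restrict (Ioo (0 : ℝ) 1)) :=
    (Lp.memLp g).integrable (by norm_num)
  have h2 : IntervalIntegrable g volume 0 1 := by
    rw [intervalIntegrable_iff_integrableOn_Ioo_of_le zero_le_one]
    exact h1
  refine h2.mono_set ?_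
  rw [uIcc_of_le hx.1, uIcc_of_le zero_le_one]
  exact Icc_subset_Icc le_rfl hx.2

theorem L2Interval.integral_congr {g : L2Interval} {φ : ℝ → ℂ}
    (h : g =ᵐ[(volume : Measure ℝ).restrict (Ioo (0 : ℝ) 1)] φ) {x : ℝ}
    (hx : x ∈ Icc (0 : ℝ) 1) : ∫ t in (0 : ℝ)..x, g t = ∫ t in (0 : ℝ)..x, φ t := by
  rw [intervalIntegral.integral_of_le hx.1, intervalIntegral.integral_of_le hx.1,
    ← Measure.restrict_congr_set Ioo_ae_eq_Ioc]
  exact integral_congr_ae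
    (ae_mono (Measure.restrict_mono (Ioo_subset_Ioo le_rfl hx.2) le_rfl) h)

theorem L2Interval.integral_add (g g' : L2Interval) {x : ℝ} (hx : x ∈ Icc (0 : ℝ) 1) :
    ∫ t in (0 : ℝ)..x, (g + g' : L2Interval) t
      = (∫ t in (0 : ℝ)..x, g t) + ∫ t in (0 : ℝ)..x, g' t := by
  rw [L2Interval.integral_congr (Lp.coeFn_add g g') hx]
  exact intervalIntegral.integral_add (g.intervalIntegrable hx) (g'.intervalIntegrable hx)

theorem L2Interval.integral_smul (k : ℂ) (g : L2Interval) {x : ℝ} (hx : x ∈ Icc (0 : ℝ) 1) :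
    ∫ t in (0 : ℝ)..x, (k • g : L2Interval) t = k * ∫ t in (0 : ℝ)..x, g t := by
  rw [L2Interval.integral_congr (Lp.coeFn_smul k g) hx]
  exact intervalIntegral.integral_smul k _

theorem L2Interval.integral_zero {x : ℝ} (hx : x ∈ Icc (0 : ℝ) 1) :
    ∫ t in (0 : ℝ)..x, (0 : L2Interval) t = 0 := by
  rw [L2Interval.integral_congr (Lp.coeFn_zero ℂ 2 _) hx]
  simp

theorem IsPrimitive.zero : IsPrimitive 0 0 0 := by
  filter_upwards [Lp.coeFn_zero ℂ 2 ((volume : Measure ℝ).restrict (Ioo (0 : ℝ) 1)),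
    ae_restrict_mem measurableSet_Ioo] with x h1 hx
  rw [h1, L2Interval.integral_zero (Ioo_subset_Icc_self hx)]
  simp

theorem IsPrimitive.add {a a' : ℂ} {g g' f f' : L2Interval} (h : IsPrimitive a g f)
    (h' : IsPrimitive a' g' f') : IsPrimitive (a + a') (g + g') (f + f') := by
  filter_upwards [h, h', Lp.coeFn_add f f', ae_restrict_mem measurableSet_Ioo]
    with x h1 h2 h3 hx
  rw [h3, Pi.add_apply, h1, h2, L2Interval.integral_add g g' (Ioo_subset_Icc_self hx)]
  ring

theorem IsPrimitive.smul (k : ℂ) {a : ℂ} {g f : L2Interval} (h : IsPrimitive a g f) :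
    IsPrimitive (k * a) (k • g) (k • f) := by
  filter_upwards [h, Lp.coeFn_smul k f, ae_restrict_mem measurableSet_Ioo] with x h1 h3 hx
  rw [h3, Pi.smul_apply, h1, L2Interval.integral_smul k g (Ioo_subset_Icc_self hx), smul_eq_mul]
  ring

theorem IsPrimitive.deriv_eq_zero {a : ℂ} {g : L2Interval} (h : IsPrimitive a g 0) : g = 0 := by
  have hcont : ContinuousOn (fun x => a + ∫ t in (0 : ℝ)..x, g t) (Ioo (0 : ℝ) 1) := by
    have := intervalIntegral.continuousOn_primitive_interval' (a := (0 : ℝ))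
      (g.intervalIntegrable (x := 1) (by simp)) (by simp)
    rw [uIcc_of_le zero_le_one] at this
    exact continuousOn_const.add (this.mono Ioo_subset_Icc_self)
  have hzero : EqOn (fun x => a + ∫ t in (0 : ℝ)..x, g t) (fun _ => 0) (Ioo (0 : ℝ) 1) := by
    refine Measure.eqOn_open_of_ae_eq (μ := volume) ?_ isOpen_Ioo hcont continuousOn_const
    filter_upwards [h, Lp.coeFn_zero ℂ 2 ((volume : Measure ℝ).restrict (Ioo (0 : ℝ) 1))]
      with x h1 h2
    rw [← h1, h2]
    rfl
  refine Lp.ext ?_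
  have hd := (g.intervalIntegrable (x := 1) (by simp)).ae_hasDerivAt_integral
  filter_upwards [ae_restrict_of_ae hd, ae_restrict_mem measurableSet_Ioo,
    Lp.coeFn_zero ℂ 2 ((volume : Measure ℝ).restrict (Ioo (0 : ℝ) 1))] with x h1 hx h2
  rw [h2, Pi.zero_apply]
  have h3 := h1 (by rw [uIcc_of_le zero_le_one]; exact Ioo_subset_Icc_self hx) 0 (by simp)
  have h4 : HasDerivAt (fun x => a + ∫ t in (0 : ℝ)..x, g t) (g x) x := h3.const_add a
  have h5 : HasDerivAt (fun x => a + ∫ t in (0 : ℝ)..x, g t) 0 x :=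
    (hasDerivAt_const x (0 : ℂ)).congr_of_eventuallyEq
      (Filter.eventuallyEq_of_mem (isOpen_Ioo.mem_nhds hx) hzero)
  exact h4.unique h5

theorem IsPrimitive.deriv_unique {a a' : ℂ} {g g' f : L2Interval} (h : IsPrimitive a g f)
    (h' : IsPrimitive a' g' f) : g = g' := by
  have := h.add (h'.smul (-1))
  have h0 : f + (-1 : ℂ) • f = 0 := by simp
  rw [h0] at this
  have := this.deriv_eq_zero
  simpa [← sub_eq_add_neg, sub_eq_zero] using this

end Interval

/-! ## Schrödinger operators on a metric graph with edges of length one -/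

section Graph

variable {E V : Type*} [Fintype E]

/-- `⨁_{e ∈ E} L₂(0,1)`. -/
abbrev L2Graph (E : Type*) [Fintype E] : Type _ := PiLp 2 (fun _ : E => L2Interval)

/-- For a graph in which the edge `e` runs from `src e` to `tgt e`: every component `f_e` lies
in `W₂¹(0,1)` with derivative `g_e`, and `f` is continuous at all vertices, the common
value at `v` of the components on the edges adjacent to `v` being `c v`. -/
def IsSobolev (src tgt : E → V) (f g : L2Graph E) (c : V → ℂ) : Prop :=
  ∀ e, IsPrimitive (c (src e)) (g e) (f e) ∧
    c (tgt e) = c (src e) + ∫ t in (0 : ℝ)..1, (g e) t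

/-- The Sobolev space `W₂¹` of a finite metric graph. -/
def sobolevSpace (src tgt : E → V) : Submodule ℂ (L2Graph E) where
  carrier := {f | ∃ g c, IsSobolev src tgt f g c}
  zero_mem' := ⟨0, 0, fun e => ⟨IsPrimitive.zero, by
    have := L2Interval.integral_zero (x := 1) (by simp)
    simp only [PiLp.zero_apply, this]
    simp⟩⟩
  add_mem' := by
    rintro f f' ⟨g, c, h⟩ ⟨g', c', h'⟩
    refine ⟨g + g', c + c', fun e => ⟨(h e).1.add (h' e).1, ?_⟩⟩
    rw [PiLp.add_apply, L2Interval.integral_add _ _ (by simp), Pi.add_apply, Pi.add_apply,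
      (h e).2, (h' e).2]
    ring
  smul_mem' := by
    rintro k f ⟨g, c, h⟩
    refine ⟨k • g, k • c, fun e => ⟨(h e).1.smul k, ?_⟩⟩
    rw [PiLp.smul_apply, L2Interval.integral_smul _ _ (by simp), Pi.smul_apply, Pi.smul_apply,
      (h e).2, smul_eq_mul, smul_eq_mul]
    ring

/-- The edgewise derivative `f'` of `f ∈ W₂¹`. -/
noncomputable def sobolevDeriv (src tgt : E → V) (f : sobolevSpace src tgt) : L2Graph E :=
  f.2.choose

theorem sobolevDeriv_eq {src tgt : E → V} {f : sobolevSpace src tgt} {g : L2Graph E}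
    {c : V → ℂ} (h : IsSobolev src tgt f g c) : sobolevDeriv src tgt f = g := by
  obtain ⟨c', h'⟩ := f.2.choose_spec
  exact PiLp.ext fun e => (h' e).1.deriv_unique (h e).1

theorem sobolevDeriv_spec {src tgt : E → V} (f : sobolevSpace src tgt) :
    ∃ c, IsSobolev src tgt f (sobolevDeriv src tgt f) c :=
  f.2.choose_spec

theorem sobolevDeriv_add {src tgt : E → V} (f f' : sobolevSpace src tgt) :
    sobolevDeriv src tgt (f + f') = sobolevDeriv src tgt f + sobolevDeriv src tgt f' := by
  obtain ⟨c, h⟩ := sobolevDeriv_spec f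
  obtain ⟨c', h'⟩ := sobolevDeriv_spec f'
  refine sobolevDeriv_eq (c := c + c') fun e => ⟨(h e).1.add (h' e).1, ?_⟩
  rw [PiLp.add_apply, L2Interval.integral_add _ _ (by simp), Pi.add_apply, Pi.add_apply,
    (h e).2, (h' e).2]
  ring

theorem sobolevDeriv_smul {src tgt : E → V} (k : ℂ) (f : sobolevSpace src tgt) :
    sobolevDeriv src tgt (k • f) = k • sobolevDeriv src tgt f := by
  obtain ⟨c, h⟩ := sobolevDeriv_spec f
  refine sobolevDeriv_eq (c := k • c) fun e => ⟨(h e).1.smul k, ?_⟩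
  rw [PiLp.smul_apply, L2Interval.integral_smul _ _ (by simp), Pi.smul_apply, Pi.smul_apply,
    (h e).2, smul_eq_mul, smul_eq_mul]
  ring

/-- The form `𝔥(f, g) = ∑ₑ [(f'ₑ | g'ₑ) + (qₑ fₑ | gₑ)]` on `W₂¹`, for a potential that is
constant on each edge. -/
noncomputable def graphForm (src tgt : E → V) (q : E → ℝ) :
    sobolevSpace src tgt →ₗ⋆[ℂ] sobolevSpace src tgt →ₗ[ℂ] ℂ :=
  LinearMap.mk₂'ₛₗ (starRingEnd ℂ) (RingHom.id ℂ)
    (fun f g => ∑ e, (⟪sobolevDeriv src tgt f e, sobolevDeriv src tgt g e⟫_ℂ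
      + (q e : ℂ) * ⟪(f : L2Graph E) e, (g : L2Graph E) e⟫_ℂ))
    (fun f f' g => by
      rw [← Finset.sum_add_distrib]
      refine Finset.sum_congr rfl fun e _ => ?_
      simp only [sobolevDeriv_add, Submodule.coe_add, PiLp.add_apply, inner_add_left]
      ring)
    (fun k f g => by
      rw [smul_eq_mul, Finset.mul_sum]
      refine Finset.sum_congr rfl fun e _ => ?_
      simp only [sobolevDeriv_smul, Submodule.coe_smul, PiLp.smul_apply, inner_smul_left]
      ring)
    (fun f g g' => by
      rw [← Finset.sum_add_distrib]
      refine Finset.sum_congr rfl fun e _ => ?_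
      simp only [sobolevDeriv_add, Submodule.coe_add, PiLp.add_apply, inner_add_right]
      ring)
    (fun k f g => by
      rw [smul_eq_mul, Finset.mul_sum]
      refine Finset.sum_congr rfl fun e _ => ?_
      simp only [sobolevDeriv_smul, Submodule.coe_smul, PiLp.smul_apply, inner_smul_right,
        RingHom.id_apply]
      ring)

theorem exists_isPrimitive_of_smooth {φ : ℝ → ℝ} (hφ : ContDiff ℝ ((⊤ : ℕ∞) : WithTop ℕ∞) φ)
    (hc : HasCompactSupport φ) (hs : tsupport φ ⊆ Ioo (0 : ℝ) 1) :
    ∃ g f : L2Interval, IsPrimitive 0 g f ∧ ∫ t in (0 : ℝ)..1, g t = 0 ∧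
      f =ᵐ[(volume : Measure ℝ).restrict (Ioo (0 : ℝ) 1)] fun x => (φ x : ℂ) := by
  have hφc : ContDiff ℝ ((⊤ : ℕ∞) : WithTop ℕ∞) fun x => (φ x : ℂ) := Complex.ofRealCLM.contDiff.comp hφ
  have hcc : HasCompactSupport fun x => (φ x : ℂ) :=
    hc.comp_left (g := fun x : ℝ => (x : ℂ)) Complex.ofReal_zero
  have hd : Continuous (deriv fun x => (φ x : ℂ)) := hφc.continuous_deriv (by simp)
  have m1 : MemLp (deriv fun x => (φ x : ℂ)) 2 ((volume : Measure ℝ).restrict (Ioo (0 : ℝ) 1)) :=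
    (hd.memLp_of_hasCompactSupport hcc.deriv).restrict _
  have m0 : MemLp (fun x => (φ x : ℂ)) 2 ((volume : Measure ℝ).restrict (Ioo (0 : ℝ) 1)) :=
    (hφc.continuous.memLp_of_hasCompactSupport hcc).restrict _
  have hout : ∀ x, x ∉ Ioo (0 : ℝ) 1 → φ x = 0 := fun x hx =>
    image_eq_zero_of_notMem_tsupport fun h => hx (hs h)
  have key : ∀ x ∈ Icc (0 : ℝ) 1, ∫ t in (0 : ℝ)..x, m1.toLp _ t = φ x := by
    intro x hx
    rw [L2Interval.integral_congr m1.coeFn_toLp hx,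
      intervalIntegral.integral_deriv_eq_sub
        (fun y _ => (hφc.differentiable (by simp)) y) (hd.intervalIntegrable _ _),
      hout 0 (by simp)]
    simp
  refine ⟨m1.toLp _, m0.toLp _, ?_, ?_, m0.coeFn_toLp⟩
  · filter_upwards [m0.coeFn_toLp, ae_restrict_mem measurableSet_Ioo] with x h1 hx
    rw [h1, key x (Ioo_subset_Icc_self hx), zero_add]
  · rw [key 1 (by simp), hout 1 (by simp)]
    simp

theorem dense_sobolevSpace (src tgt : E → V) :
    Dense (sobolevSpace src tgt : Set (L2Graph E)) := by
  classical
  rw [Submodule.dense_iff_topologicalClosure_eq_top,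
    Submodule.topologicalClosure_eq_top_iff, Submodule.eq_bot_iff]
  intro v hv
  refine PiLp.ext fun e₀ => Lp.ext ?_
  have hint : Integrable (v e₀) ((volume : Measure ℝ).restrict (Ioo (0 : ℝ) 1)) :=
    (Lp.memLp (v e₀)).integrable (by norm_num)
  have hloc : LocallyIntegrableOn (v e₀) (Ioo (0 : ℝ) 1) volume :=
    IntegrableOn.locallyIntegrableOn hint
  have := isOpen_Ioo.ae_eq_zero_of_integral_contDiff_smul_eq_zero hloc ?_
  · have h2 := (ae_restrict_iff' (μ := (volume : Measure ℝ)) measurableSet_Ioo).2 this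
    filter_upwards [h2, Lp.coeFn_zero ℂ 2 ((volume : Measure ℝ).restrict (Ioo (0 : ℝ) 1))]
      with x h3 h4
    rw [h3, PiLp.zero_apply, h4]
    rfl
  intro φ hφ hc hs
  obtain ⟨g, f, hp, hg, hf⟩ := exists_isPrimitive_of_smooth hφ hc hs
  have hmem : (PiLp.single 2 e₀ f : L2Graph E) ∈ sobolevSpace src tgt := by
    refine ⟨PiLp.single 2 e₀ g, 0, fun e => ?_⟩
    by_cases he : e = e₀
    · subst he
      simp [hp, hg]
    · rw [PiLp.single_eq_of_ne 2 he, PiLp.single_eq_of_ne 2 he,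
        L2Interval.integral_zero (by simp)]
      simp [IsPrimitive.zero]
  have h0 := (Submodule.mem_orthogonal _ _).1 hv _ hmem
  rw [PiLp.inner_apply, Finset.sum_eq_single e₀ (fun e _ he => by simp [he])
    (fun h => absurd (Finset.mem_univ _) h), PiLp.single_eq_same, L2.inner_def] at h0
  rw [← setIntegral_eq_integral_of_forall_compl_eq_zero (s := Ioo (0 : ℝ) 1), ← h0]
  · refine integral_congr_ae ?_
    filter_upwards [hf] with x hx
    rw [hx, RCLike.inner_apply]
    simp [mul_comm]
  · intro x hx
    rw [image_eq_zero_of_notMem_tsupport fun h => hx (hs h), zero_smul]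

/-- The operator `-f''ₑ + qₑ fₑ` on a finite metric graph with Kirchhoff (free) conditions at
all vertices, defined through its form. -/
noncomputable def graphSchrodinger (src tgt : E → V) (q : E → ℝ) :
    L2Graph E →ₗ.[ℂ] L2Graph E :=
  formOperator (sobolevSpace src tgt) (dense_sobolevSpace src tgt) (graphForm src tgt q)

end Graph

/-! ## The cubic lattice graph and its restriction to boxes -/

section Lattice

variable {d : ℕ}

/-- The edges of the cubic lattice: `(v, k)` is the segment from `v` to `v + e_k`. -/
abbrev LatticeEdge (d : ℕ) : Type := (Fin d → ℤ) × Fin d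

/-- The initial vertex of an edge. -/
def LatticeEdge.initial (e : LatticeEdge d) : Fin d → ℤ := e.1

/-- The terminal vertex of an edge. -/
def LatticeEdge.terminal (e : LatticeEdge d) : Fin d → ℤ := e.1 + Pi.single e.2 1

/-- A vertex as a point of `ℝᵈ`. -/
def latticePoint (v : Fin d → ℤ) : Fin d → ℝ := fun k => (v k : ℝ)

/-- The closed line segment of an edge. -/
def LatticeEdge.closedSegment (e : LatticeEdge d) : Set (Fin d → ℝ) :=
  segment ℝ (latticePoint e.initial) (latticePoint e.terminal)

/-- The line segment of an edge without its endpoints. -/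
def LatticeEdge.interiorSegment (e : LatticeEdge d) : Set (Fin d → ℝ) :=
  openSegment ℝ (latticePoint e.initial) (latticePoint e.terminal)

/-- The domain `Λ` respects the edges of the lattice graph: each edge either is contained in
the boundary of `Λ` or meets it at most in its endpoints. -/
def IsEdgeBounded (Λ : Set (Fin d → ℝ)) : Prop :=
  ∀ e : LatticeEdge d, e.closedSegment ⊆ frontier Λ ∨
    e.closedSegment ∩ frontier Λ ⊆ {latticePoint e.initial, latticePoint e.terminal}

/-- The edges of `Γ ∩ Λ`: those that run inside the open set `Λ`, so that the edges outside `Λ`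
and the edges in the boundary of `Λ` are deleted. -/
def edgesIn (Λ : Set (Fin d → ℝ)) : Set (LatticeEdge d) :=
  {e | e.interiorSegment ⊆ Λ}

/-- The open cube `Λ_l(i)` with centre `i` and side length `l`. -/
def box (i : Fin d → ℤ) (l : ℝ) : Set (Fin d → ℝ) :=
  {x | ∀ k, |x k - i k| < l / 2}

theorem finite_edgesIn_box (i : Fin d → ℤ) (l : ℝ) : (edgesIn (box i l)).Finite := by
  have hfin : (Set.pi univ fun k => Icc (⌊(i k : ℝ) - l / 2 - 1⌋) (⌈(i k : ℝ) + l / 2⌉)).Finite :=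
    Set.Finite.pi fun k => Set.finite_Icc _ _
  refine (hfin.prod (Set.finite_univ (α := Fin d))).subset ?_
  rintro ⟨v, j⟩ he
  refine ⟨fun k _ => ?_, mem_univ _⟩
  have hm : midpoint ℝ (latticePoint v) (latticePoint (v + Pi.single j 1)) ∈ box i l :=
    he (midpoint_mem_openSegment _ _)
  have hk := hm k
  rw [abs_lt, pi_midpoint_apply, midpoint_eq_smul_add] at hk
  simp only [latticePoint, Pi.add_apply, smul_eq_mul, invOf_eq_inv, Int.cast_add] at hk
  have hs : (0 : ℝ) ≤ ((Pi.single j (1 : ℤ) : Fin d → ℤ) k : ℝ) ∧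
      ((Pi.single j (1 : ℤ) : Fin d → ℤ) k : ℝ) ≤ 1 := by
    by_cases h : k = j
    · subst h
      simp
    · simp [h]
  constructor
  · exact Int.cast_le (R := ℝ) |>.1 ((Int.floor_le _).trans (by linarith))
  · exact Int.cast_le (R := ℝ) |>.1 (le_trans (by linarith) (Int.le_ceil _))

noncomputable instance fintypeEdgesInBox (i : Fin d → ℤ) (l : ℝ) :
    Fintype (edgesIn (box i l)) :=
  (finite_edgesIn_box i l).fintype

/-- The restriction `H^N_Λ(ω)` to the box `Λ = Λ_l(i)`, with Neumann conditions at the boundary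
vertices, for the coupling constants `ω`. -/
noncomputable def neumannOperator (i : Fin d → ℤ) (l : ℝ) (ω : LatticeEdge d → ℝ) :
    L2Graph (edgesIn (box i l)) →ₗ.[ℂ] L2Graph (edgesIn (box i l)) :=
  graphSchrodinger (V := Fin d → ℤ) (fun e => e.1.initial) (fun e => e.1.terminal)
    (fun e => ω e.1)

end Lattice

/-- `μ` is Hölder continuous with exponent `α`: intervals of length `ε` have measure at most a
constant times `ε ^ α`. -/
def IsHolderMeasure (μ : Measure ℝ) (α : ℝ) : Prop :=
  ∃ K : ℝ, ∀ a b : ℝ, a ≤ b → μ.real (Icc a b) ≤ K * (b - a) ^ α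

/-!
The estimate combines a deterministic description of the spectrum with a statement about monotone
functions of independent random variables.

*Spectrum.* On the `M` subintervals of equal length of an edge, a function in `W₂¹` differs from its
value at the left endpoint by at most `M^(-1/2) ‖f'‖` (`IsSobolev.exists_norm_sub_step_le`). So, up
to the finite-dimensional space of step functions, `f` is controlled by `f'` with a small constant.
This has two consequences. First, `(-Δ + 1)⁻¹`, obtained by an orthogonal projection onto the closed
graph of the weak derivative, is a norm limit of operators of finite rank, and the Fredholm
alternative shows that every point of the spectrum is an eigenvalue
(`exists_eigenvector_of_mem_spectrum`). Second, a subspace on which the form lies below a level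
`x < R` has dimension at most `M |E|`, where `M` depends only on `R` and the lower bound of the
potential (`finrank_le_of_graphEnergy_lt`). Hence every eigenvalue below `R` is one of the
first `M |E| + 1` min-max levels `minMaxLevel` (`exists_minMaxLevel_eq`).

*Probability.* Each min-max level is a monotone function of the coupling constants and moves by `t`
when all of them are raised by `t`. If such a function `Φ` takes a value in `[a, b]`, then raising
all coordinates by `ε > b - a`, one after the other, makes `Φ` cross the level `b` at one of `|E|`
steps. For fixed values of the other coordinates, the values of the coordinate being raised for
which the crossing occurs form a set of diameter at most `ε`, of measure at most `K ε^α`. Therefore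
`Φ ∈ [a, b]` has probability at most `|E| K (b - a)^α` (`pi_preimage_Icc_le`).

Summing over the `M |E| + 1` levels and using `|E| ≤ const · |Λ|` (`card_edgesIn_box_le`) gives the
factor `|Λ|²`.
-/

/-! ### Monotone functions of independent variables -/

section Stollmann

variable {J : Type*} {Φ : (J → ℝ) → ℝ}

theorem abs_sub_le_of_monotone_of_shift (hmono : Monotone Φ)
    (hshift : ∀ (ω : J → ℝ) (t : ℝ), Φ (fun e => ω e + t) = Φ ω + t) {ω ω' : J → ℝ} {δ : ℝ}
    (h : ∀ e, |ω e - ω' e| ≤ δ) : |Φ ω - Φ ω'| ≤ δ := by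
  have h1 : Φ ω ≤ Φ fun e => ω' e + δ := hmono fun e => by linarith [(abs_le.1 (h e)).2]
  have h2 : Φ ω' ≤ Φ fun e => ω e + δ := hmono fun e => by linarith [(abs_le.1 (h e)).1]
  rw [hshift] at h1 h2
  exact abs_le.2 ⟨by linarith, by linarith⟩

theorem continuous_of_monotone_of_shift [Fintype J] (hmono : Monotone Φ)
    (hshift : ∀ (ω : J → ℝ) (t : ℝ), Φ (fun e => ω e + t) = Φ ω + t) : Continuous Φ := by
  refine (LipschitzWith.of_dist_le' (K := 1) fun ω ω' => ?_).continuous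
  rw [one_mul, Real.dist_eq]
  refine abs_sub_le_of_monotone_of_shift hmono hshift fun e => ?_
  rw [← Real.dist_eq]
  exact dist_le_pi_dist ω ω' e

theorem exists_subset_Icc_of_sub_le {T : Set ℝ} {ε : ℝ}
    (hT : ∀ s ∈ T, ∀ t ∈ T, t - s ≤ ε) : ∃ x, T ⊆ Icc x (x + ε) := by
  rcases T.eq_empty_or_nonempty with rfl | ⟨t₀, ht₀⟩
  · exact ⟨0, empty_subset _⟩
  have hb : BddBelow T := ⟨t₀ - ε, fun s hs => by linarith [hT s hs t₀ ht₀]⟩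
  refine ⟨sInf T, fun t ht => ⟨csInf_le hb ht, ?_⟩⟩
  have : t - ε ≤ sInf T := le_csInf ⟨t₀, ht₀⟩ fun s hs => by linarith [hT s hs t ht]
  linarith

variable [Fintype J] [DecidableEq J] {μ : Measure ℝ} [IsProbabilityMeasure μ]

/-- In a single coordinate direction, a monotone function crosses the level `b` under a shift by
`ε` only on a set each of whose one-dimensional sections has diameter at most `ε`. -/
theorem pi_crossing_single_le (hmono : Monotone Φ) (hmeas : Measurable Φ) {ε : ℝ}
    {c : ENNReal} (hc : ∀ x, μ (Icc x (x + ε)) ≤ c) (b : ℝ) (j : J) :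
    Measure.pi (fun _ : J => μ) {ω | Φ ω ≤ b ∧ b < Φ (ω + Pi.single j ε)} ≤ c := by
  set A : Set (J → ℝ) := {ω | Φ ω ≤ b ∧ b < Φ (ω + Pi.single j ε)}
  have hA : MeasurableSet A :=
    (measurableSet_le hmeas measurable_const).inter
      (measurableSet_lt measurable_const (hmeas.comp (measurable_id.add_const _)))
  have key : ∫⁻ ω, A.indicator 1 ω ∂(Measure.pi fun _ : J => μ)
      ≤ ∫⁻ _, c ∂(Measure.pi fun _ : J => μ) := by
    refine lintegral_le_of_lmarginal_le {j} (measurable_one.indicator hA) measurable_const ?_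
    intro ω
    rw [lmarginal_singleton, lmarginal_singleton]
    have hsec : MeasurableSet {t | Function.update ω j t ∈ A} :=
      measurable_update ω hA
    have hpt : ∀ t, A.indicator (1 : (J → ℝ) → ENNReal) (Function.update ω j t)
        = {t | Function.update ω j t ∈ A}.indicator 1 t := fun t => by
      simp [indicator_apply]
    simp only [hpt, lintegral_indicator_one hsec, lintegral_const, measure_univ, mul_one]
    have hdiam : ∀ s ∈ {t | Function.update ω j t ∈ A}, ∀ t ∈ {t | Function.update ω j t ∈ A},
        t - s ≤ ε := by
      intro s hs t ht
      by_contra! hlt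
      have hle : Function.update ω j s + Pi.single j ε ≤ Function.update ω j t := by
        intro k
        by_cases hk : k = j
        · subst hk
          simp only [Pi.add_apply, Function.update_self, Pi.single_eq_same]
          linarith
        · simp [hk]
      exact absurd (hmono hle) (not_le.2 (ht.1.trans_lt hs.2))
    obtain ⟨x, hx⟩ := exists_subset_Icc_of_sub_le hdiam
    exact (measure_mono hx).trans (hc x)
  rwa [lintegral_indicator_one hA, lintegral_const, measure_univ, mul_one] at key

/-- Raising the coordinates in `s` one after the other: a crossing of the level `b` happens at one
of the `#s` steps. -/
theorem pi_crossing_finset_le (hmono : Monotone Φ) (hmeas : Measurable Φ) {ε : ℝ}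
    {c : ENNReal} (hc : ∀ x, μ (Icc x (x + ε)) ≤ c) (b : ℝ) (s : Finset J) :
    Measure.pi (fun _ : J => μ) {ω | Φ ω ≤ b ∧ b < Φ (ω + ∑ j ∈ s, Pi.single j ε)}
      ≤ s.card * c := by
  induction s using Finset.induction_on with
  | empty =>
    have : {ω : J → ℝ | Φ ω ≤ b ∧ b < Φ (ω + ∑ j ∈ (∅ : Finset J), Pi.single j ε)} = ∅ := by
      ext ω
      simp
    simp only [this, measure_empty, Finset.card_empty, Nat.cast_zero, zero_mul, le_refl]
  | insert j s hj ih =>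
    set v : J → ℝ := ∑ k ∈ s, Pi.single k ε
    have hstep := pi_crossing_single_le (Φ := fun ω => Φ (ω + v))
      (fun ω ω' h => hmono (add_le_add_left h v)) (hmeas.comp (measurable_id.add_const v)) hc b j
    rw [Finset.card_insert_of_notMem hj, Nat.cast_add, Nat.cast_one, add_mul, one_mul]
    refine le_trans (measure_mono ?_) ((measure_union_le _ _).trans (add_le_add ih hstep))
    rintro ω ⟨h1, h2⟩
    rw [Finset.sum_insert hj, ← add_assoc] at h2
    rcases le_or_gt (Φ (ω + v)) b with h | h
    · exact Or.inr ⟨h, h2⟩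
    · exact Or.inl ⟨h1, h⟩

/-- **Stollmann's lemma.** A monotone function of independent variables that grows at unit rate
under simultaneous shifts of all variables takes values in `[a, b]` with probability at most the
number of variables times the modulus of continuity of their common distribution. -/
theorem pi_preimage_Icc_le (hmono : Monotone Φ)
    (hshift : ∀ (ω : J → ℝ) (t : ℝ), Φ (fun e => ω e + t) = Φ ω + t) {K α : ℝ} (hα : 0 < α)
    (hμ : ∀ a b : ℝ, a ≤ b → μ.real (Icc a b) ≤ K * (b - a) ^ α) {a b : ℝ} (hab : a ≤ b) :
    (Measure.pi fun _ : J => μ).real {ω | Φ ω ∈ Icc a b}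
      ≤ Fintype.card J * (K * (b - a) ^ α) := by
  have hmeas : Measurable Φ := (continuous_of_monotone_of_shift hmono hshift).measurable
  have hK : 0 ≤ K := by
    have := measureReal_nonneg.trans (hμ 0 1 zero_le_one)
    simpa using this
  -- A shift by more than `b - a` moves every value in `[a, b]` strictly above `b`.
  have hε : ∀ ε, b - a < ε → (Measure.pi fun _ : J => μ).real {ω | Φ ω ∈ Icc a b}
      ≤ Fintype.card J * (K * ε ^ α) := by
    intro ε hε
    have h0 : 0 ≤ ε := by linarith
    have hc : ∀ x, μ (Icc x (x + ε)) ≤ ENNReal.ofReal (K * ε ^ α) := fun x => by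
      have := hμ x (x + ε) (by linarith)
      rw [add_sub_cancel_left] at this
      rw [← ofReal_measureReal]
      exact ENNReal.ofReal_le_ofReal this
    have h1 := pi_crossing_finset_le hmono hmeas hc b Finset.univ
    have h2 : Measure.pi (fun _ : J => μ) {ω | Φ ω ∈ Icc a b}
        ≤ Fintype.card J * ENNReal.ofReal (K * ε ^ α) := by
      refine (measure_mono ?_).trans h1
      rintro ω ⟨hωa, hωb⟩
      refine ⟨hωb, ?_⟩
      have : ω + ∑ j, Pi.single j ε = fun e => ω e + ε := by
        ext e
        simp [Finset.sum_apply, Pi.single_apply]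
      rw [this, hshift]
      linarith
    rw [measureReal_def]
    refine ENNReal.toReal_le_of_le_ofReal (by positivity) (h2.trans_eq ?_)
    rw [ENNReal.ofReal_mul (Nat.cast_nonneg _), ENNReal.ofReal_natCast]
  have hlim : Filter.Tendsto (fun ε : ℝ => (Fintype.card J : ℝ) * (K * ε ^ α))
      (nhdsWithin (b - a) (Ioi (b - a))) (nhds (Fintype.card J * (K * (b - a) ^ α))) := by
    refine Filter.Tendsto.mono_left ?_ nhdsWithin_le_nhds
    exact ((Real.continuousAt_rpow_const _ _ (Or.inr hα.le)).const_mul K).const_mul _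
  exact ge_of_tendsto hlim (Filter.eventually_of_mem self_mem_nhdsWithin hε)

end Stollmann

/-! ### The Poincaré inequality -/

section Poincare

/-- The Cauchy–Schwarz inequality, applied to `g` and the characteristic function of `(s, x]`. -/
theorem L2Interval.norm_integral_le (g : L2Interval) {s x : ℝ} (hs : 0 ≤ s) (hsx : s ≤ x)
    (hx : x ≤ 1) : ‖∫ t in s..x, g t‖ ≤ √(x - s) * ‖g‖ := by
  have hm : MeasurableSet (Ioc s x) := measurableSet_Ioc
  have hvol : (volume : Measure ℝ).restrict (Ioo (0 : ℝ) 1) (Ioc s x) = ENNReal.ofReal (x - s) := by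
    rw [← Real.volume_Ioo (a := s) (b := x), ← measure_congr (Ioo_ae_eq_Ioc (μ := _)),
      Measure.restrict_apply measurableSet_Ioo,
      inter_eq_left.2 (Ioo_subset_Ioo hs hx)]
  have hfin : (volume : Measure ℝ).restrict (Ioo (0 : ℝ) 1) (Ioc s x) ≠ ⊤ := by
    rw [hvol]; exact ENNReal.ofReal_ne_top
  have h1 : ∫ t in s..x, g t = ⟪indicatorConstLp 2 hm hfin (1 : ℂ), g⟫_ℂ := by
    rw [L2.inner_indicatorConstLp_one, intervalIntegral.integral_of_le hsx,
      Measure.restrict_restrict hm, ← Measure.restrict_congr_set Ioo_ae_eq_Ioc]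
    congr 1
    refine Measure.restrict_congr_set ?_
    have := (Ioo_ae_eq_Ioc (μ := (volume : Measure ℝ)) (a := s) (b := x)).inter
      (Filter.EventuallyEq.refl _ (Ioo (0 : ℝ) 1))
    rwa [inter_eq_left.2 (Ioo_subset_Ioo hs hx)] at this
  rw [h1]
  refine (norm_inner_le_norm _ _).trans_eq ?_
  rw [norm_indicatorConstLp (by norm_num) (by norm_num), measureReal_def, hvol,
    ENNReal.toReal_ofReal (by linarith), norm_one, one_mul, Real.sqrt_eq_rpow]
  norm_num

/-- The characteristic function of the `k`-th of `M` subintervals of `(0,1)` of equal length. -/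
noncomputable def stepIndicator (M k : ℕ) : L2Interval :=
  indicatorConstLp 2 (s := {x : ℝ | ⌊M * x⌋₊ = k})
    (Nat.measurable_floor.comp (measurable_const_mul (M : ℝ)) (measurableSet_singleton k))
    (measure_ne_top _ _) (1 : ℂ)

/-- A function in `W₂¹(0,1)` is approximated in `L₂` by the step function that takes its value at
the left endpoint of each of the `M` subintervals. -/
theorem IsPrimitive.norm_sub_step_le {a : ℂ} {g f : L2Interval} (h : IsPrimitive a g f) {M : ℕ}
    (hM : 0 < M) :
    ‖f - ∑ k ∈ Finset.range M, (a + ∫ t in (0 : ℝ)..(k / M : ℝ), g t) • stepIndicator M k‖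
      ≤ √(1 / M) * ‖g‖ := by
  have hM' : (0 : ℝ) < M := Nat.cast_pos.2 hM
  have hw : (∑ k ∈ Finset.range M, (a + ∫ t in (0 : ℝ)..(k / M : ℝ), g t) • stepIndicator M k :
      L2Interval) =ᵐ[(volume : Measure ℝ).restrict (Ioo (0 : ℝ) 1)]
      fun x => a + ∫ t in (0 : ℝ)..(⌊M * x⌋₊ / M : ℝ), g t := by
    refine (Lp.coeFn_fun_finsetSum _ _).trans ?_
    have h1 : ∀ᵐ x ∂((volume : Measure ℝ).restrict (Ioo (0 : ℝ) 1)), ∀ k : ℕ,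
        ((a + ∫ t in (0 : ℝ)..(k / M : ℝ), g t) • stepIndicator M k : L2Interval) x
          = if ⌊M * x⌋₊ = k then a + ∫ t in (0 : ℝ)..(k / M : ℝ), g t else 0 := by
      refine ae_all_iff.2 fun k => ?_
      filter_upwards [Lp.coeFn_smul (a + ∫ t in (0 : ℝ)..(k / M : ℝ), g t) (stepIndicator M k),
        indicatorConstLp_coeFn (p := 2) (s := {x : ℝ | ⌊M * x⌋₊ = k})
          (hs := Nat.measurable_floor.comp (measurable_const_mul (M : ℝ))
            (measurableSet_singleton k))
          (hμs := measure_ne_top ((volume : Measure ℝ).restrict (Ioo (0 : ℝ) 1)) _)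
          (c := (1 : ℂ))] with x h2 h3
      rw [h2, Pi.smul_apply, stepIndicator, h3, indicator_apply]
      simp only [mem_ofPred_eq, smul_eq_mul, mul_ite, mul_one, mul_zero]
    filter_upwards [h1, ae_restrict_mem measurableSet_Ioo] with x h2 hx
    have hfl : ⌊M * x⌋₊ < M := by
      rw [Nat.floor_lt (by nlinarith [hx.1])]
      nlinarith [hx.2]
    simp only [h2]
    rw [Finset.sum_ite_eq, if_pos (Finset.mem_range.2 hfl)]
  have hb : ∀ᵐ x ∂((volume : Measure ℝ).restrict (Ioo (0 : ℝ) 1)),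
      ‖(f - ∑ k ∈ Finset.range M, (a + ∫ t in (0 : ℝ)..(k / M : ℝ), g t) • stepIndicator M k :
        L2Interval) x‖ ≤ √(1 / M) * ‖g‖ := by
    filter_upwards [Lp.coeFn_sub f (∑ k ∈ Finset.range M,
      (a + ∫ t in (0 : ℝ)..(k / M : ℝ), g t) • stepIndicator M k), h, hw,
      ae_restrict_mem measurableSet_Ioo] with x h1 h2 h3 hx
    have hx0 : 0 ≤ M * x := by nlinarith [hx.1]
    have h4 : (⌊M * x⌋₊ / M : ℝ) ≤ x := by
      rw [div_le_iff₀ hM', mul_comm x]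
      exact Nat.floor_le hx0
    have h5 : x - (⌊M * x⌋₊ / M : ℝ) ≤ 1 / M := by
      rw [sub_le_iff_le_add, ← add_div, le_div_iff₀ hM', mul_comm x, add_comm]
      exact (Nat.lt_floor_add_one _).le
    have h6 : (0 : ℝ) ≤ ⌊M * x⌋₊ / M := by positivity
    rw [h1, Pi.sub_apply, h2, h3, add_sub_add_left_eq_sub,
      intervalIntegral.integral_interval_sub_left
        (g.intervalIntegrable (Ioo_subset_Icc_self hx))
        (g.intervalIntegrable ⟨h6, h4.trans hx.2.le⟩)]
    refine (g.norm_integral_le h6 h4 hx.2.le).trans ?_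
    gcongr
  have := Lp.norm_le_of_ae_bound (by positivity) hb
  rwa [measureUnivNNReal, Measure.restrict_apply_univ, Real.volume_Ioo, sub_zero,
    ENNReal.ofReal_one, ENNReal.toNNReal_one, NNReal.coe_one, Real.one_rpow,
    one_mul] at this

variable {E V : Type*} [Fintype E] [DecidableEq E]

/-- The functions on the graph that are constant on each of `M` pieces of equal length of every
edge. -/
noncomputable def stepSpace (E : Type*) [Fintype E] [DecidableEq E] (M : ℕ) :
    Submodule ℂ (L2Graph E) :=
  Submodule.span ℂ
    (Set.range fun p : E × Fin M => (PiLp.single 2 p.1 (stepIndicator M p.2) : L2Graph E))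

instance (M : ℕ) : FiniteDimensional ℂ (stepSpace E M) :=
  FiniteDimensional.span_of_finite ℂ (Set.finite_range _)

theorem finrank_stepSpace_le (M : ℕ) :
    Module.finrank ℂ (stepSpace E M) ≤ M * Fintype.card E := by
  refine (finrank_range_le_card _).trans_eq ?_
  rw [Fintype.card_prod, Fintype.card_fin, mul_comm]

/-- The Poincaré inequality: up to a step function with `M` steps per edge, a function in `W₂¹` is
controlled by its derivative, with a constant that tends to zero as `M` grows. -/
theorem IsSobolev.exists_norm_sub_step_le {src tgt : E → V} {f g : L2Graph E} {c : V → ℂ}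
    (h : IsSobolev src tgt f g c) {M : ℕ} (hM : 0 < M) :
    ∃ w ∈ stepSpace E M, ‖f - w‖ ^ 2 ≤ 1 / M * ‖g‖ ^ 2 := by
  set φ : E → L2Interval := fun e => ∑ k ∈ Finset.range M,
    (c (src e) + ∫ t in (0 : ℝ)..(k / M : ℝ), g e t) • stepIndicator M k with hφ
  refine ⟨∑ e, PiLp.single 2 e (φ e), ?_, ?_⟩
  · refine Submodule.sum_mem _ fun e _ => ?_
    have : (PiLp.single 2 e (φ e) : L2Graph E) = ∑ k ∈ Finset.range M,
        (c (src e) + ∫ t in (0 : ℝ)..(k / M : ℝ), g e t) •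
          (PiLp.single 2 e (stepIndicator M k) : L2Graph E) := by
      refine PiLp.ext fun e' => ?_
      by_cases he : e' = e
      · subst he
        simp [hφ]
      · simp [he]
    rw [this]
    refine Submodule.sum_mem _ fun k hk => Submodule.smul_mem _ _ (Submodule.subset_span ?_)
    exact ⟨(e, ⟨k, Finset.mem_range.1 hk⟩), rfl⟩
  · have hcomp : ∀ e, (∑ e', PiLp.single 2 e' (φ e') : L2Graph E) e = φ e := fun e => by
      simp [Pi.single_apply]
    rw [PiLp.norm_sq_eq_of_L2, PiLp.norm_sq_eq_of_L2, Finset.mul_sum]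
    refine Finset.sum_le_sum fun e _ => ?_
    rw [PiLp.sub_apply, hcomp]
    have := pow_le_pow_left₀ (norm_nonneg _) ((h e).1.norm_sub_step_le hM) 2
    rwa [mul_pow, Real.sq_sqrt (by positivity)] at this

end Poincare

/-! ### Closedness of the weak derivative -/

section Closed

theorem L2Interval.memLp_primitive (g : L2Interval) :
    MemLp (fun x => ∫ t in (0 : ℝ)..x, g t) 2 ((volume : Measure ℝ).restrict (Ioo (0 : ℝ) 1)) := by
  have hc : ContinuousOn (fun x => ∫ t in (0 : ℝ)..x, g t) (Ioo (0 : ℝ) 1) := by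
    have := intervalIntegral.continuousOn_primitive_interval' (a := (0 : ℝ))
      (g.intervalIntegrable (x := 1) (by simp)) (by simp)
    rw [uIcc_of_le zero_le_one] at this
    exact this.mono Ioo_subset_Icc_self
  refine MemLp.of_bound (hc.aestronglyMeasurable measurableSet_Ioo) ‖g‖ ?_
  filter_upwards [ae_restrict_mem measurableSet_Ioo] with x hx
  refine (g.norm_integral_le le_rfl hx.1.le hx.2.le).trans ?_
  refine mul_le_of_le_one_left (norm_nonneg _) ?_
  exact Real.sqrt_le_one.2 (by linarith [hx.2])

/-- The Volterra operator `g ↦ (x ↦ ∫₀ˣ g)` on `L₂(0,1)`. -/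
noncomputable def volterra : L2Interval →L[ℂ] L2Interval :=
  LinearMap.mkContinuous
    { toFun := fun g => g.memLp_primitive.toLp _
      map_add' := fun g g' => by
        rw [← MemLp.toLp_add]
        refine MemLp.toLp_congr _ _ ?_
        filter_upwards [ae_restrict_mem measurableSet_Ioo] with x hx
        exact L2Interval.integral_add g g' (Ioo_subset_Icc_self hx)
      map_smul' := fun k g => by
        rw [RingHom.id_apply, ← MemLp.toLp_const_smul]
        refine MemLp.toLp_congr _ _ ?_
        filter_upwards [ae_restrict_mem measurableSet_Ioo] with x hx
        exact L2Interval.integral_smul k g (Ioo_subset_Icc_self hx) }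
    1 fun g => by
      have hb : ∀ᵐ x ∂((volume : Measure ℝ).restrict (Ioo (0 : ℝ) 1)),
          ‖(g.memLp_primitive.toLp _ : L2Interval) x‖ ≤ ‖g‖ := by
        filter_upwards [g.memLp_primitive.coeFn_toLp, ae_restrict_mem measurableSet_Ioo]
          with x h1 hx
        rw [h1]
        refine (g.norm_integral_le le_rfl hx.1.le hx.2.le).trans ?_
        refine mul_le_of_le_one_left (norm_nonneg _) ?_
        exact Real.sqrt_le_one.2 (by linarith [hx.2])
      have := Lp.norm_le_of_ae_bound (norm_nonneg _) hb
      rwa [measureUnivNNReal, Measure.restrict_apply_univ, Real.volume_Ioo, sub_zero,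
        ENNReal.ofReal_one, ENNReal.toNNReal_one, NNReal.coe_one, Real.one_rpow] at this

theorem volterra_coeFn (g : L2Interval) :
    volterra g =ᵐ[(volume : Measure ℝ).restrict (Ioo (0 : ℝ) 1)]
      fun x => ∫ t in (0 : ℝ)..x, g t :=
  g.memLp_primitive.coeFn_toLp

/-- The constant function one in `L₂(0,1)`. -/
noncomputable def oneL2 : L2Interval :=
  indicatorConstLp 2 MeasurableSet.univ (measure_ne_top _ _) (1 : ℂ)

theorem oneL2_coeFn :
    oneL2 =ᵐ[(volume : Measure ℝ).restrict (Ioo (0 : ℝ) 1)] fun _ => 1 := by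
  refine indicatorConstLp_coeFn.trans ?_
  simp

theorem isPrimitive_iff {a : ℂ} {g f : L2Interval} :
    IsPrimitive a g f ↔ f = a • oneL2 + volterra g := by
  have h : (a • oneL2 + volterra g : L2Interval)
      =ᵐ[(volume : Measure ℝ).restrict (Ioo (0 : ℝ) 1)] fun x => a + ∫ t in (0 : ℝ)..x, g t := by
    filter_upwards [Lp.coeFn_add (a • oneL2) (volterra g), Lp.coeFn_smul a oneL2, oneL2_coeFn,
      volterra_coeFn g] with x h1 h2 h3 h4
    rw [h1, Pi.add_apply, h2, Pi.smul_apply, h3, h4, smul_eq_mul, mul_one]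
  exact ⟨fun h' => Lp.ext (Filter.EventuallyEq.trans h' h.symm), fun h' => by subst h'; exact h⟩

theorem inner_oneL2 (g : L2Interval) : ⟪oneL2, g⟫_ℂ = ∫ t in (0 : ℝ)..1, g t := by
  rw [oneL2, L2.inner_indicatorConstLp_one, intervalIntegral.integral_of_le zero_le_one,
    Measure.restrict_univ]
  exact integral_Ioc_eq_integral_Ioo.symm

theorem inner_oneL2_self : ⟪oneL2, oneL2⟫_ℂ = 1 := by
  rw [inner_oneL2, L2Interval.integral_congr oneL2_coeFn (by simp)]
  simp

variable {E V : Type*} [Fintype E]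

/-- The pairs `(f, f')` of a function in `W₂¹` of the graph and its derivative. -/
def sobolevGraph (src tgt : E → V) : Submodule ℂ (WithLp 2 (L2Graph E × L2Graph E)) where
  carrier := {p | ∃ c, IsSobolev src tgt p.fst p.snd c}
  zero_mem' := ⟨0, fun e => ⟨IsPrimitive.zero, by
    rw [WithLp.zero_snd, PiLp.zero_apply, L2Interval.integral_zero (by simp)]
    simp⟩⟩
  add_mem' := by
    rintro p p' ⟨c, h⟩ ⟨c', h'⟩
    refine ⟨c + c', fun e => ⟨(h e).1.add (h' e).1, ?_⟩⟩
    rw [WithLp.add_snd, PiLp.add_apply, L2Interval.integral_add _ _ (by simp), Pi.add_apply,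
      Pi.add_apply, (h e).2, (h' e).2]
    ring
  smul_mem' := by
    rintro k p ⟨c, h⟩
    refine ⟨k • c, fun e => ⟨(h e).1.smul k, ?_⟩⟩
    rw [WithLp.smul_snd, PiLp.smul_apply, L2Interval.integral_smul _ _ (by simp), Pi.smul_apply,
      Pi.smul_apply, (h e).2, smul_eq_mul, smul_eq_mul]
    ring

/-- The values at the endpoints of the edges that come from values at the vertices. -/
def endpointValues (src tgt : E → V) : Submodule ℂ ((E → ℂ) × (E → ℂ)) :=
  LinearMap.range ((LinearMap.funLeft ℂ ℂ src).prod (LinearMap.funLeft ℂ ℂ tgt))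

/-- The weak derivative is a closed operator: on each edge, the identity `f = f(0) + ∫₀ˣ f'`
passes to limits in `L₂`, the boundary values `f(0)` and `f(1)` depend continuously on `(f, f')`,
and the continuity at the vertices is a condition on boundary values in a space of finite
dimension. -/
theorem isClosed_sobolevGraph (src tgt : E → V) :
    IsClosed (sobolevGraph src tgt : Set (WithLp 2 (L2Graph E × L2Graph E))) := by
  set α : E → WithLp 2 (L2Graph E × L2Graph E) → ℂ := fun e p =>
    ⟪oneL2, p.fst e - volterra (p.snd e)⟫_ℂ with hα
  have hαc : ∀ e, Continuous (α e) := fun e => by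
    fun_prop
  have hset : (sobolevGraph src tgt : Set (WithLp 2 (L2Graph E × L2Graph E)))
      = {p | (∀ e, p.fst e = α e p • oneL2 + volterra (p.snd e)) ∧
          ((fun e => α e p, fun e => α e p + ⟪oneL2, p.snd e⟫_ℂ) : (E → ℂ) × (E → ℂ))
            ∈ (endpointValues src tgt : Set _)} := by
    ext p
    constructor
    · rintro ⟨c, h⟩
      have hc : ∀ e, α e p = c (src e) := fun e => by
        simp only [hα]
        rw [isPrimitive_iff.1 (h e).1, add_sub_cancel_right, inner_smul_right, inner_oneL2_self,
          mul_one]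
      refine ⟨fun e => by rw [hc]; exact isPrimitive_iff.1 (h e).1, c, ?_⟩
      refine Prod.ext (funext fun e => (hc e).symm) (funext fun e => ?_)
      simp only [hc, inner_oneL2]
      exact (h e).2
    · rintro ⟨h1, c, hc⟩
      have h2 : ∀ e, c (src e) = α e p := fun e => congrFun (congrArg Prod.fst hc) e
      have h3 : ∀ e, c (tgt e) = α e p + ⟪oneL2, p.snd e⟫_ℂ := fun e =>
        congrFun (congrArg Prod.snd hc) e
      refine ⟨c, fun e => ⟨isPrimitive_iff.2 ?_, ?_⟩⟩
      · rw [h2]; exact h1 e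
      · rw [h3, h2, inner_oneL2]
  rw [hset, ofPred_and, ofPred_forall]
  refine IsClosed.inter ?_ ?_
  · refine isClosed_iInter fun e => isClosed_eq (by fun_prop) ?_
    have := hαc e
    fun_prop
  · exact (Submodule.closed_of_finiteDimensional _).preimage (by fun_prop)

end Closed

/-! ### Compactness of the resolvent and discreteness of the spectrum -/

section Resolvent

variable {E V : Type*} [Fintype E]

/-- Multiplication by the potential that takes the value `q e` on the edge `e`. -/
noncomputable def potentialCLM (q : E → ℝ) : L2Graph E →L[ℂ] L2Graph E :=
  ((PiLp.continuousLinearEquiv 2 ℂ fun _ : E => L2Interval).symm :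
      (E → L2Interval) →L[ℂ] L2Graph E) ∘L
    ContinuousLinearMap.pi fun e => (q e : ℂ) • PiLp.proj 2 (fun _ : E => L2Interval) e

theorem potentialCLM_apply (q : E → ℝ) (f : L2Graph E) (e : E) :
    potentialCLM q f e = (q e : ℂ) • f e := rfl

theorem graphForm_apply {src tgt : E → V} (q : E → ℝ) (v u : sobolevSpace src tgt) :
    graphForm src tgt q v u = ⟪sobolevDeriv src tgt v, sobolevDeriv src tgt u⟫_ℂ
      + ⟪(v : L2Graph E), potentialCLM q u⟫_ℂ := by
  rw [PiLp.inner_apply, PiLp.inner_apply, ← Finset.sum_add_distrib]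
  refine Finset.sum_congr rfl fun e _ => ?_
  rw [potentialCLM_apply, inner_smul_right]

instance (src tgt : E → V) : (sobolevGraph src tgt).HasOrthogonalProjection := by
  have := (isClosed_sobolevGraph src tgt).completeSpace_coe
  infer_instance

theorem mem_sobolevGraph {src tgt : E → V} (u : sobolevSpace src tgt) :
    (WithLp.toLp 2 ((u : L2Graph E), sobolevDeriv src tgt u)
      : WithLp 2 (L2Graph E × L2Graph E)) ∈ sobolevGraph src tgt :=
  sobolevDeriv_spec u

/-- The resolvent `(-Δ + 1)⁻¹` of the free operator on the graph, obtained by projecting `(f, 0)`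
orthogonally onto the graph of the weak derivative: the projection `(u, u')` is characterised by
`(v' | u') + (v | u) = (v | f)` for all `v` in `W₂¹`, which is the weak form of `-u'' + u = f`. -/
noncomputable def freeResolvent (src tgt : E → V) : L2Graph E →L[ℂ] L2Graph E :=
  ContinuousLinearMap.fst ℂ (L2Graph E) (L2Graph E) ∘L
    (WithLp.prodContinuousLinearEquiv 2 ℂ (L2Graph E) (L2Graph E) :
      WithLp 2 (L2Graph E × L2Graph E) →L[ℂ] L2Graph E × L2Graph E) ∘L
    (sobolevGraph src tgt).starProjection ∘L
    ((WithLp.prodContinuousLinearEquiv 2 ℂ (L2Graph E) (L2Graph E)).symm :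
      L2Graph E × L2Graph E →L[ℂ] WithLp 2 (L2Graph E × L2Graph E)) ∘L
    ContinuousLinearMap.inl ℂ (L2Graph E) (L2Graph E)

theorem freeResolvent_apply (src tgt : E → V) (f : L2Graph E) :
    freeResolvent src tgt f
      = ((sobolevGraph src tgt).starProjection (WithLp.toLp 2 (f, 0))).fst := rfl

theorem exists_freeResolvent (src tgt : E → V) (f : L2Graph E) :
    ∃ hu : freeResolvent src tgt f ∈ sobolevSpace src tgt, ∀ v : sobolevSpace src tgt,
      ⟪sobolevDeriv src tgt v, sobolevDeriv src tgt ⟨_, hu⟩⟫_ℂ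
        + ⟪(v : L2Graph E), freeResolvent src tgt f⟫_ℂ = ⟪(v : L2Graph E), f⟫_ℂ := by
  set p := (sobolevGraph src tgt).starProjection (WithLp.toLp 2 (f, 0)) with hp
  obtain ⟨c, hc⟩ : ∃ c, IsSobolev src tgt p.fst p.snd c :=
    (sobolevGraph src tgt).starProjection_apply_mem _
  have hD : freeResolvent src tgt f ∈ sobolevSpace src tgt := ⟨p.snd, c, hc⟩
  have hd : sobolevDeriv src tgt ⟨_, hD⟩ = p.snd := sobolevDeriv_eq (c := c) hc
  refine ⟨hD, fun v => ?_⟩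
  rw [hd, freeResolvent_apply, ← hp]
  have h := Submodule.starProjection_inner_eq_zero (K := sobolevGraph src tgt)
    (WithLp.toLp 2 (f, 0)) _ (mem_sobolevGraph v)
  rw [inner_eq_zero_symm, inner_sub_right, sub_eq_zero, WithLp.prod_inner_apply,
    WithLp.prod_inner_apply, ← hp] at h
  simp only [inner_zero_right, add_zero] at h
  rw [h, add_comm]
  rfl

theorem freeResolvent_eq {src tgt : E → V} {f : L2Graph E} {u : sobolevSpace src tgt}
    (h : ∀ v : sobolevSpace src tgt, ⟪sobolevDeriv src tgt v, sobolevDeriv src tgt u⟫_ℂ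
      + ⟪(v : L2Graph E), (u : L2Graph E)⟫_ℂ = ⟪(v : L2Graph E), f⟫_ℂ) :
    freeResolvent src tgt f = u := by
  have := Submodule.eq_starProjection_of_mem_of_inner_eq_zero
    (u := (WithLp.toLp 2 (f, 0) : WithLp 2 (L2Graph E × L2Graph E))) (mem_sobolevGraph u) ?_
  · rw [freeResolvent_apply, this]
    rfl
  rintro p ⟨c, hc⟩
  have hd := sobolevDeriv_eq (f := ⟨p.fst, p.snd, c, hc⟩) hc
  have hv := h ⟨p.fst, p.snd, c, hc⟩
  rw [hd] at hv
  rw [inner_eq_zero_symm, inner_sub_right, sub_eq_zero, WithLp.prod_inner_apply,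
    WithLp.prod_inner_apply]
  simp only [inner_zero_right, add_zero]
  rw [add_comm]
  exact hv.symm

theorem norm_sobolevDeriv_freeResolvent_le (src tgt : E → V) (f : L2Graph E) :
    ‖sobolevDeriv src tgt ⟨freeResolvent src tgt f, (exists_freeResolvent src tgt f).1⟩‖
      ≤ ‖f‖ := by
  obtain ⟨hu, h⟩ := exists_freeResolvent src tgt f
  have h1 := congrArg Complex.re (h ⟨_, hu⟩)
  have h2 : (⟪freeResolvent src tgt f, f⟫_ℂ).re ≤ ‖freeResolvent src tgt f‖ * ‖f‖ :=
    re_inner_le_norm (𝕜 := ℂ) _ _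
  rw [Complex.add_re] at h1
  have h3 := norm_sq_eq_re_inner (𝕜 := ℂ) (sobolevDeriv src tgt ⟨freeResolvent src tgt f, hu⟩)
  have h4 := norm_sq_eq_re_inner (𝕜 := ℂ) (freeResolvent src tgt f)
  simp only [RCLike.re_to_complex] at h3 h4
  rw [← h3, ← h4] at h1
  refine abs_le_of_sq_le_sq' ?_ (norm_nonneg _) |>.2
  nlinarith [sq_nonneg (‖freeResolvent src tgt f‖ - ‖f‖), norm_nonneg f]

/-- An operator whose values are approximated, relative to the norm of the argument, by elements of
finite-dimensional subspaces is compact. -/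
theorem isCompactOperator_of_approx {H : Type*} [NormedAddCommGroup H] [InnerProductSpace ℂ H]
    [CompleteSpace H] (T : H →L[ℂ] H)
    (h : ∀ ε > 0, ∃ W : Submodule ℂ H, FiniteDimensional ℂ W ∧
      ∀ f, ∃ w ∈ W, ‖T f - w‖ ≤ ε * ‖f‖) : IsCompactOperator T := by
  have hmem : T ∈ closure {A : H →L[ℂ] H | IsCompactOperator A} := by
    refine Metric.mem_closure_iff.2 fun ε hε => ?_
    obtain ⟨W, hW, hT⟩ := h (ε / 2) (half_pos hε)
    have : ProperSpace W := FiniteDimensional.proper ℂ W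
    have hP : IsCompactOperator (W.subtypeL ∘L W.orthogonalProjectionOnto ∘L T) :=
      ((isCompactOperator_id (E := W)).comp_clm (W.orthogonalProjectionOnto ∘L T)).clm_comp
        W.subtypeL
    refine ⟨_, hP, ?_⟩
    rw [dist_eq_norm]
    refine lt_of_le_of_lt (ContinuousLinearMap.opNorm_le_bound _ (half_pos hε).le fun f => ?_)
      (half_lt_self hε)
    obtain ⟨w, hw, hle⟩ := hT f
    refine le_trans ?_ hle
    have := Submodule.starProjection_minimal (U := W) (T f)
    exact this.trans_le (ciInf_le ⟨0, forall_mem_range.2 fun _ => norm_nonneg _⟩ (⟨w, hw⟩ : W))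
  exact isClosed_setOfPred_isCompactOperator.closure_subset hmem

theorem isCompactOperator_freeResolvent (src tgt : E → V) :
    IsCompactOperator (freeResolvent src tgt) := by
  classical
  refine isCompactOperator_of_approx _ fun ε hε => ?_
  obtain ⟨M, hM⟩ := exists_nat_one_div_lt (sq_pos_of_pos hε)
  refine ⟨stepSpace E (M + 1), inferInstance, fun f => ?_⟩
  obtain ⟨c, hc⟩ := sobolevDeriv_spec ⟨freeResolvent src tgt f, (exists_freeResolvent src tgt f).1⟩
  obtain ⟨w, hw, hle⟩ := hc.exists_norm_sub_step_le (M := M + 1) (Nat.succ_pos M)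
  refine ⟨w, hw, (abs_le_of_sq_le_sq' ?_ (by positivity)).2⟩
  rw [mul_pow]
  push_cast at hle
  refine hle.trans ?_
  gcongr
  exact norm_sobolevDeriv_freeResolvent_le src tgt f

/-- The spectrum of the Schrödinger operator consists of eigenvalues. With `S = (-Δ + 1)⁻¹` the
equation `(-Δ + q - z) u = f` reads `(1 - K) u = S f` for the compact operator
`K = S (1 + z - q)`, so the Fredholm alternative applies. -/
theorem exists_eigenvector_of_mem_spectrum {src tgt : E → V} {q : E → ℝ} {z : ℂ}
    (hz : z ∈ unboundedSpectrum (graphSchrodinger src tgt q)) :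
    ∃ u : sobolevSpace src tgt, u ≠ 0 ∧ ∀ v : sobolevSpace src tgt,
      graphForm src tgt q v u = z * ⟪(v : L2Graph E), (u : L2Graph E)⟫_ℂ := by
  set S := freeResolvent src tgt with hS
  set B : L2Graph E →L[ℂ] L2Graph E :=
    (1 + z) • ContinuousLinearMap.id ℂ (L2Graph E) - potentialCLM q with hB
  have hBinner : ∀ v u : L2Graph E,
      ⟪v, B u⟫_ℂ = ⟪v, u⟫_ℂ + z * ⟪v, u⟫_ℂ - ⟪v, potentialCLM q u⟫_ℂ := fun v u => by
    simp only [hB, sub_apply, smul_apply,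
      ContinuousLinearMap.id_apply, inner_sub_right, inner_smul_right]
    ring
  have hcomp : IsCompactOperator (S ∘L B) := (isCompactOperator_freeResolvent src tgt).comp_clm B
  rcases hcomp.hasEigenvalue_or_mem_resolventSet one_ne_zero with h | h
  · obtain ⟨u, hu⟩ := h.exists_hasEigenvector
    have hSu : S (B u) = u := by
      have := hu.apply_eq_smul
      rwa [one_smul] at this
    obtain ⟨hD, hform⟩ := exists_freeResolvent src tgt (B u)
    have hD' : u ∈ sobolevSpace src tgt := by rw [← hSu]; exact hD
    have heq : (⟨_, hD⟩ : sobolevSpace src tgt) = ⟨u, hD'⟩ := Subtype.ext hSu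
    refine ⟨⟨u, hD'⟩, fun h0 => hu.2 (congrArg Subtype.val h0), fun v => ?_⟩
    have := hform v
    rw [heq, ← hS, hSu, hBinner] at this
    rw [graphForm_apply]
    linear_combination this
  · refine absurd ?_ hz
    rw [spectrum.mem_resolventSet_iff, map_one] at h
    obtain ⟨U, hU⟩ := h
    have hl : ∀ f, (↑U⁻¹ : L2Graph E →L[ℂ] L2Graph E) (f - S (B f)) = f := fun f => by
      have := congrArg (fun A : L2Graph E →L[ℂ] L2Graph E => A f) U.inv_mul
      simpa [hU] using this
    have hr : ∀ f, (↑U⁻¹ : L2Graph E →L[ℂ] L2Graph E) f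
        - S (B ((↑U⁻¹ : L2Graph E →L[ℂ] L2Graph E) f)) = f := fun f => by
      have := congrArg (fun A : L2Graph E →L[ℂ] L2Graph E => A f) U.mul_inv
      simpa [hU] using this
    refine ⟨↑U⁻¹ ∘L S, fun f => ?_, fun u => ?_⟩
    · set u := (↑U⁻¹ : L2Graph E →L[ℂ] L2Graph E) (S f) with hu
      have hSu : S (f + B u) = u := by
        rw [map_add]
        exact (eq_add_of_sub_eq (hr (S f))).symm
      obtain ⟨hD, hform⟩ := exists_freeResolvent src tgt (f + B u)
      have hD' : u ∈ sobolevSpace src tgt := by rw [← hSu]; exact hD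
      have heq : (⟨_, hD⟩ : sobolevSpace src tgt) = ⟨u, hD'⟩ := Subtype.ext hSu
      obtain ⟨hdom, happ⟩ := (formOperator_apply_eq_iff _ (dense_sobolevSpace src tgt)
        (graphForm src tgt q) u (f + z • u)).2 ⟨hD', fun v => by
          have := hform v
          rw [heq, ← hS, hSu, inner_add_right, hBinner] at this
          rw [graphForm_apply, inner_add_right, inner_smul_right]
          linear_combination this⟩
      exact ⟨hdom, sub_eq_of_eq_add happ⟩
    · obtain ⟨hD, hform⟩ := (formOperator_apply_eq_iff _ (dense_sobolevSpace src tgt)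
        (graphForm src tgt q) u (graphSchrodinger src tgt q u)).1 ⟨u.2, rfl⟩
      have hSu : S (graphSchrodinger src tgt q u - z • (u : L2Graph E) + B u) = u := by
        refine freeResolvent_eq (u := (⟨u, hD⟩ : sobolevSpace src tgt)) fun v => ?_
        have := hform v
        rw [graphForm_apply] at this
        rw [inner_add_right, inner_sub_right, hBinner, inner_smul_right]
        linear_combination this
      rw [map_add, ← eq_sub_iff_add_eq] at hSu
      rw [ContinuousLinearMap.comp_apply, hSu]
      exact hl u

end Resolvent

/-! ### The min-max principle -/

section MinMax

variable {E V : Type*} [Fintype E] {src tgt : E → V}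

/-- The quadratic form `∑ₑ ‖u'ₑ‖² + qₑ ‖uₑ‖²` of the Schrödinger operator. -/
noncomputable def graphEnergy (src tgt : E → V) (q : E → ℝ) (u : sobolevSpace src tgt) : ℝ :=
  ‖sobolevDeriv src tgt u‖ ^ 2 + ∑ e, q e * ‖(u : L2Graph E) e‖ ^ 2

theorem graphForm_self (q : E → ℝ) (u : sobolevSpace src tgt) :
    graphForm src tgt q u u = graphEnergy src tgt q u := by
  rw [graphForm_apply, graphEnergy, inner_self_eq_norm_sq_to_K, PiLp.inner_apply]
  simp only [potentialCLM_apply, inner_smul_right, inner_self_eq_norm_sq_to_K]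
  push_cast
  rfl

theorem graphForm_conj (q : E → ℝ) (u v : sobolevSpace src tgt) :
    (starRingEnd ℂ) (graphForm src tgt q u v) = graphForm src tgt q v u := by
  change (starRingEnd ℂ) (∑ e, _) = ∑ e, _
  rw [map_sum]
  refine Finset.sum_congr rfl fun e _ => ?_
  simp only [map_add, map_mul, inner_conj_symm, Complex.conj_ofReal]

theorem norm_sq_eq_sum (u : sobolevSpace src tgt) :
    ‖u‖ ^ 2 = ∑ e, ‖(u : L2Graph E) e‖ ^ 2 :=
  PiLp.norm_sq_eq_of_L2 _ _

theorem graphEnergy_mono {q q' : E → ℝ} (h : q ≤ q') (u : sobolevSpace src tgt) :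
    graphEnergy src tgt q u ≤ graphEnergy src tgt q' u := by
  unfold graphEnergy
  gcongr with e
  exact h e

theorem graphEnergy_shift (q : E → ℝ) (t : ℝ) (u : sobolevSpace src tgt) :
    graphEnergy src tgt (fun e => q e + t) u = graphEnergy src tgt q u + t * ‖u‖ ^ 2 := by
  simp only [graphEnergy, norm_sq_eq_sum, add_mul, Finset.sum_add_distrib, Finset.mul_sum]
  ring

theorem graphEnergy_const (t : ℝ) (u : sobolevSpace src tgt) :
    graphEnergy src tgt (fun _ => t) u = ‖sobolevDeriv src tgt u‖ ^ 2 + t * ‖u‖ ^ 2 := by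
  simp only [graphEnergy, norm_sq_eq_sum, Finset.mul_sum]

theorem abs_le_sum_abs (q : E → ℝ) (e : E) : |q e| ≤ ∑ e, |q e| :=
  Finset.single_le_sum (f := fun e => |q e|) (fun _ _ => abs_nonneg _) (Finset.mem_univ e)

theorem neg_mul_norm_sq_le_graphEnergy (q : E → ℝ) (u : sobolevSpace src tgt) :
    -(∑ e, |q e|) * ‖u‖ ^ 2 ≤ graphEnergy src tgt q u := by
  refine le_trans ?_ (graphEnergy_mono (q := fun _ => -∑ e, |q e|) (fun e => ?_) u)
  · rw [graphEnergy_const]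
    exact le_add_of_nonneg_left (sq_nonneg _)
  · linarith [neg_abs_le (q e), abs_le_sum_abs q e]

/-- The levels `x` such that the quadratic form is at most `x ‖u‖²` on some subspace of dimension
`n + 1`. -/
def energyLevels (src tgt : E → V) (n : ℕ) (q : E → ℝ) : Set ℝ :=
  {x | ∃ W : Submodule ℂ (sobolevSpace src tgt), Module.finrank ℂ W = n + 1 ∧
    ∀ u ∈ W, graphEnergy src tgt q u ≤ x * ‖u‖ ^ 2}

/-- The `n`-th eigenvalue (counted from zero, with multiplicity) of the Schrödinger operator with
potential `q`, given by the min-max principle. This is meaningful only if `W₂¹` has a subspace of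
dimension `n + 1`; otherwise it is the infimum of the empty set. -/
noncomputable def minMaxLevel (src tgt : E → V) (n : ℕ) (q : E → ℝ) : ℝ :=
  sInf (energyLevels src tgt n q)

theorem bddBelow_energyLevels (n : ℕ) (q : E → ℝ) : BddBelow (energyLevels src tgt n q) := by
  refine ⟨-∑ e, |q e|, ?_⟩
  rintro x ⟨W, hW, hx⟩
  have hne : Nontrivial W := Module.nontrivial_of_finrank_pos (R := ℂ) (by omega)
  obtain ⟨⟨u, huW⟩, hu⟩ := exists_ne (0 : W)
  have hpos : 0 < ‖u‖ ^ 2 := by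
    have : u ≠ 0 := fun h => hu (Subtype.ext h)
    positivity
  exact le_of_mul_le_mul_right ((neg_mul_norm_sq_le_graphEnergy q u).trans (hx u huW)) hpos

theorem LinearMap.exists_norm_le_on_finiteDimensional {F G : Type*} [NormedAddCommGroup F]
    [NormedSpace ℂ F] [NormedAddCommGroup G] [NormedSpace ℂ G] (W : Submodule ℂ F)
    [FiniteDimensional ℂ W] (D : F →ₗ[ℂ] G) : ∃ C : ℝ, ∀ u ∈ W, ‖D u‖ ≤ C * ‖u‖ := by
  let T : W →L[ℂ] G := LinearMap.toContinuousLinearMap (D ∘ₗ W.subtype)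
  exact ⟨‖T‖, fun u hu => T.le_opNorm ⟨u, hu⟩⟩

theorem energyLevels_nonempty {n : ℕ}
    (hn : ∃ W : Submodule ℂ (sobolevSpace src tgt), Module.finrank ℂ W = n + 1) (q : E → ℝ) :
    (energyLevels src tgt n q).Nonempty := by
  obtain ⟨W, hW⟩ := hn
  have hfin : FiniteDimensional ℂ W := Module.finite_of_finrank_pos (by omega)
  let D : sobolevSpace src tgt →ₗ[ℂ] L2Graph E :=
    { toFun := sobolevDeriv src tgt
      map_add' := sobolevDeriv_add
      map_smul' := sobolevDeriv_smul }
  obtain ⟨C, hC⟩ := D.exists_norm_le_on_finiteDimensional W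
  refine ⟨C ^ 2 + ∑ e, |q e|, W, hW, fun u hu => ?_⟩
  have h1 : ‖sobolevDeriv src tgt u‖ ≤ C * ‖u‖ := hC u hu
  refine (graphEnergy_mono (q' := fun _ => ∑ e, |q e|)
    (fun e => (le_abs_self _).trans (abs_le_sum_abs q e)) u).trans ?_
  rw [graphEnergy_const, add_mul, ← mul_pow]
  gcongr

theorem monotone_minMaxLevel {n : ℕ}
    (hn : ∃ W : Submodule ℂ (sobolevSpace src tgt), Module.finrank ℂ W = n + 1) :
    Monotone (minMaxLevel src tgt n) := by
  intro q q' hq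
  refine csInf_le_csInf (bddBelow_energyLevels n q) (energyLevels_nonempty hn q') ?_
  rintro x ⟨W, hW, hx⟩
  exact ⟨W, hW, fun u hu => (graphEnergy_mono hq u).trans (hx u hu)⟩

theorem minMaxLevel_shift {n : ℕ}
    (hn : ∃ W : Submodule ℂ (sobolevSpace src tgt), Module.finrank ℂ W = n + 1) (q : E → ℝ)
    (t : ℝ) : minMaxLevel src tgt n (fun e => q e + t) = minMaxLevel src tgt n q + t := by
  have key : ∀ (q : E → ℝ) (t : ℝ),
      minMaxLevel src tgt n (fun e => q e + t) ≤ minMaxLevel src tgt n q + t := by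
    intro q t
    rw [← sub_le_iff_le_add]
    refine le_csInf (energyLevels_nonempty hn q) ?_
    rintro x ⟨W, hW, hx⟩
    rw [sub_le_iff_le_add]
    refine csInf_le (bddBelow_energyLevels n _) ⟨W, hW, fun u hu => ?_⟩
    rw [graphEnergy_shift, add_mul]
    linarith [hx u hu]
  refine le_antisymm (key q t) ?_
  have := key (fun e => q e + t) (-t)
  simp only [add_neg_cancel_right] at this
  linarith

/-- On a subspace where the quadratic form lies below the level `x`, the orthogonal projection to
the step functions is injective, by the Poincaré inequality. -/
theorem finrank_le_of_graphEnergy_lt {q : E → ℝ} {qmin : ℝ} (hq : ∀ e, qmin ≤ q e) {x : ℝ} {M : ℕ}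
    (hM : 0 < M) (hx : x ≤ M + qmin) (W : Submodule ℂ (sobolevSpace src tgt))
    [FiniteDimensional ℂ W] (hW : ∀ u ∈ W, u ≠ 0 → graphEnergy src tgt q u < x * ‖u‖ ^ 2) :
    Module.finrank ℂ W ≤ M * Fintype.card E := by
  classical
  by_contra! hlt
  let P : W →ₗ[ℂ] stepSpace E M :=
    ((stepSpace E M).orthogonalProjectionOnto : L2Graph E →ₗ[ℂ] stepSpace E M) ∘ₗ
      (sobolevSpace src tgt).subtype ∘ₗ W.subtype
  have hker : LinearMap.ker P ≠ ⊥ :=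
    LinearMap.ker_ne_bot_of_finrank_lt ((finrank_stepSpace_le M).trans_lt hlt)
  obtain ⟨⟨u, huW⟩, hu, hu0⟩ := Submodule.exists_mem_ne_zero_of_ne_bot hker
  have hune : u ≠ 0 := fun h => hu0 (Subtype.ext h)
  have hP : (stepSpace E M).starProjection (u : L2Graph E) = 0 :=
    congrArg Subtype.val (LinearMap.mem_ker.1 hu)
  obtain ⟨c, hc⟩ := sobolevDeriv_spec u
  obtain ⟨w, hw, hle⟩ := hc.exists_norm_sub_step_le hM
  have hmin : ‖(u : L2Graph E)‖ ≤ ‖(u : L2Graph E) - w‖ := by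
    have := Submodule.starProjection_minimal (U := stepSpace E M) (u : L2Graph E)
    rw [hP, sub_zero] at this
    exact this.trans_le
      (ciInf_le ⟨0, forall_mem_range.2 fun _ => norm_nonneg _⟩ (⟨w, hw⟩ : stepSpace E M))
  have hM' : (0 : ℝ) < M := Nat.cast_pos.2 hM
  have hpoinc : M * ‖u‖ ^ 2 ≤ ‖sobolevDeriv src tgt u‖ ^ 2 := by
    have h1 : ‖u‖ ^ 2 ≤ 1 / M * ‖sobolevDeriv src tgt u‖ ^ 2 :=
      (pow_le_pow_left₀ (norm_nonneg _) hmin 2).trans hle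
    rwa [one_div_mul_eq_div, le_div_iff₀' hM'] at h1
  have h2 := graphEnergy_mono (q := fun _ => qmin) hq u
  rw [graphEnergy_const] at h2
  have h3 := hW u huW hune
  nlinarith [mul_le_mul_of_nonneg_right hx (sq_nonneg ‖u‖)]

/-- Adding an eigenvector for the eigenvalue `x` to a subspace on which the quadratic form is at
most `x ‖u‖²` preserves this bound. -/
theorem graphEnergy_add_smul_le {q : E → ℝ} {x : ℝ} {u : sobolevSpace src tgt}
    (hu : ∀ v : sobolevSpace src tgt,
      graphForm src tgt q v u = x * ⟪(v : L2Graph E), (u : L2Graph E)⟫_ℂ)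
    {v : sobolevSpace src tgt} (hv : graphEnergy src tgt q v ≤ x * ‖v‖ ^ 2) (k : ℂ) :
    graphEnergy src tgt q (v + k • u) ≤ x * ‖v + k • u‖ ^ 2 := by
  have hu' : graphForm src tgt q u v = x * ⟪(u : L2Graph E), (v : L2Graph E)⟫_ℂ := by
    rw [← graphForm_conj, hu, map_mul, inner_conj_symm, Complex.conj_ofReal]
  have hnorm : ∀ y : sobolevSpace src tgt,
      ((‖y‖ ^ 2 : ℝ) : ℂ) = ⟪(y : L2Graph E), (y : L2Graph E)⟫_ℂ := fun y => by
    rw [inner_self_eq_norm_sq_to_K]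
    push_cast
    rfl
  have key : ((graphEnergy src tgt q (v + k • u) - x * ‖v + k • u‖ ^ 2 : ℝ) : ℂ)
      = ((graphEnergy src tgt q v - x * ‖v‖ ^ 2 : ℝ) : ℂ) := by
    rw [Complex.ofReal_sub, Complex.ofReal_sub, Complex.ofReal_mul, Complex.ofReal_mul, hnorm,
      hnorm, ← graphForm_self, ← graphForm_self]
    simp only [map_add, LinearMap.add_apply, map_smulₛₗ, LinearMap.smul_apply, RingHom.id_apply,
      smul_eq_mul, Submodule.coe_add, Submodule.coe_smul, inner_add_left, inner_add_right,
      inner_smul_left, inner_smul_right, hu, hu']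
    ring
  have := Complex.ofReal_injective key
  linarith

/-- An eigenvalue `x` is attained by the min-max principle: with `n` the largest dimension of a
subspace on which the quadratic form lies strictly below `x`, adding an eigenvector to such a
subspace shows that the `n`-th level is at most `x`, and maximality shows that it is at least
`x`. -/
theorem exists_minMaxLevel_eq {q : E → ℝ} {qmin : ℝ} (hq : ∀ e, qmin ≤ q e) {x : ℝ} {M : ℕ}
    (hM : 0 < M) (hx : x ≤ M + qmin) {u : sobolevSpace src tgt} (hu0 : u ≠ 0)
    (hu : ∀ v : sobolevSpace src tgt,
      graphForm src tgt q v u = x * ⟪(v : L2Graph E), (u : L2Graph E)⟫_ℂ) :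
    ∃ n ≤ M * Fintype.card E,
      (∃ W : Submodule ℂ (sobolevSpace src tgt), Module.finrank ℂ W = n + 1) ∧
        minMaxLevel src tgt n q = x := by
  set A : Set ℕ := {m | ∃ W : Submodule ℂ (sobolevSpace src tgt), FiniteDimensional ℂ W ∧
    Module.finrank ℂ W = m ∧ ∀ v ∈ W, v ≠ 0 → graphEnergy src tgt q v < x * ‖v‖ ^ 2} with hA
  have hA0 : A.Nonempty :=
    ⟨0, ⊥, inferInstance, finrank_bot _ _, fun v hv hv0 => absurd ((Submodule.mem_bot _).1 hv) hv0⟩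
  have hAle : ∀ m ∈ A, m ≤ M * Fintype.card E := by
    rintro m ⟨W, hfin, rfl, hW⟩
    exact finrank_le_of_graphEnergy_lt hq hM hx W hW
  have hAb : BddAbove A := ⟨_, hAle⟩
  have hmem := Nat.sSup_mem hA0 hAb
  set n := sSup A
  obtain ⟨W, hfin, hWn, hW⟩ := hmem
  have hWle : ∀ v ∈ W, graphEnergy src tgt q v ≤ x * ‖v‖ ^ 2 := fun v hv => by
    by_cases hv0 : v = 0
    · have : sobolevDeriv src tgt (0 : sobolevSpace src tgt) = 0 := by
        simpa using sobolevDeriv_smul (0 : ℂ) (0 : sobolevSpace src tgt)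
      subst hv0
      simp [graphEnergy, this]
    · exact (hW v hv hv0).le
  have huW : u ∉ W := fun h => by
    have h1 : ((graphEnergy src tgt q u : ℝ) : ℂ) = ((x * ‖u‖ ^ 2 : ℝ) : ℂ) := by
      rw [← graphForm_self, hu, inner_self_eq_norm_sq_to_K]
      push_cast
      rfl
    exact (hW u h hu0).ne (Complex.ofReal_injective h1)
  have hdim : Module.finrank ℂ ↥(W ⊔ ℂ ∙ u) = n + 1 := by
    have h1 := Submodule.finrank_sup_add_finrank_inf_eq W (ℂ ∙ u)
    have h2 : W ⊓ (ℂ ∙ u) = ⊥ :=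
      (Submodule.disjoint_span_singleton' hu0).2 huW |>.eq_bot
    rw [h2, finrank_bot, finrank_span_singleton hu0, hWn] at h1
    exact h1
  have hlevel : x ∈ energyLevels src tgt n q := by
    refine ⟨W ⊔ ℂ ∙ u, hdim, fun y hy => ?_⟩
    obtain ⟨v, hv, z, hz, rfl⟩ := Submodule.mem_sup.1 hy
    obtain ⟨k, rfl⟩ := Submodule.mem_span_singleton.1 hz
    exact graphEnergy_add_smul_le hu (hWle v hv) k
  refine ⟨n, hAle n ⟨W, hfin, hWn, hW⟩, ⟨_, hdim⟩, le_antisymm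
    (csInf_le (bddBelow_energyLevels n q) hlevel) (le_csInf ⟨x, hlevel⟩ ?_)⟩
  rintro y ⟨W', hW'n, hW'⟩
  by_contra! hyx
  have hfin' : FiniteDimensional ℂ W' := Module.finite_of_finrank_pos (by omega)
  have : n + 1 ∈ A := by
    refine ⟨W', hfin', hW'n, fun v hv hv0 => (hW' v hv).trans_lt ?_⟩
    have : 0 < ‖v‖ ^ 2 := by positivity
    nlinarith
  exact absurd (le_csSup hAb this) (by simp [n])

end MinMax

/-! ### Counting edges, and the Wegner estimate -/

section Box

variable {d : ℕ}

theorem volume_real_box (i : Fin d → ℤ) {l : ℝ} (hl : 0 < l) : volume.real (box i l) = l ^ d := by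
  have h : box i l = Set.pi univ fun k => Ioo ((i k : ℝ) - l / 2) (i k + l / 2) := by
    ext x
    simp only [box, mem_ofPred_eq, mem_univ_pi, mem_Ioo, abs_lt]
    exact forall_congr' fun k => ⟨fun h => ⟨by linarith, by linarith⟩,
      fun h => ⟨by linarith, by linarith⟩⟩
  rw [h, measureReal_def, Real.volume_pi_Ioo_toReal fun k => by linarith]
  simp

/-- The midpoint of an edge inside a box satisfies the inequalities that define the box. -/
theorem abs_midpoint_sub_lt {i : Fin d → ℤ} {l : ℝ} {e : LatticeEdge d}
    (he : e ∈ edgesIn (box i l)) (k : Fin d) :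
    |(e.1 k : ℝ) + (if k = e.2 then 1 / 2 else 0) - i k| < l / 2 := by
  have hm : midpoint ℝ (latticePoint e.initial) (latticePoint e.terminal) ∈ box i l :=
    he (midpoint_mem_openSegment _ _)
  have hk := hm k
  rw [pi_midpoint_apply, midpoint_eq_smul_add] at hk
  simp only [latticePoint, LatticeEdge.initial, LatticeEdge.terminal, Pi.add_apply, smul_eq_mul,
    invOf_eq_inv, Int.cast_add] at hk
  convert hk using 3
  by_cases h : k = e.2
  · simp only [h, if_true, Pi.single_eq_same, Int.cast_one]
    ring
  · simp only [h, if_false, ne_eq, not_false_eq_true, Pi.single_eq_of_ne, Int.cast_zero]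
    ring

/-- The number of edges in a box is at most proportional to its volume. -/
theorem card_edgesIn_box_le (i : Fin d → ℤ) {l : ℝ} (hl : 0 < l) :
    (Fintype.card (edgesIn (box i l)) : ℝ) ≤ d * 3 ^ d * volume.real (box i l) := by
  rw [volume_real_box i hl]
  rcases isEmpty_or_nonempty (edgesIn (box i l)) with hE | ⟨⟨e₀, he₀⟩⟩
  · rw [Fintype.card_eq_zero, Nat.cast_zero]
    positivity
  -- The distance from the midpoint of an edge to the lattice hyperplane through the centre is a
  -- half-integer, so that a box containing an edge has side length greater than one.
  have hl1 : 1 < l := by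
    have h := abs_midpoint_sub_lt he₀ e₀.2
    rw [if_pos rfl, abs_lt] at h
    by_contra! hl1
    have h1 : (e₀.1 e₀.2 : ℝ) < i e₀.2 := by linarith [h.2]
    have h2 : (i e₀.2 : ℝ) < e₀.1 e₀.2 + 1 := by linarith [h.1]
    have h1' : e₀.1 e₀.2 < i e₀.2 := by exact_mod_cast h1
    have h2' : i e₀.2 < e₀.1 e₀.2 + 1 := by exact_mod_cast h2
    omega
  set m : ℕ := ⌊l / 2 + 1 / 2⌋₊ with hm
  have hsub : ∀ e ∈ edgesIn (box i l),
      e ∈ (Fintype.piFinset fun k => Finset.Icc (i k - m) (i k + m)) ×ˢ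
        (Finset.univ : Finset (Fin d)) := by
    intro e he
    refine Finset.mem_product.2 ⟨Fintype.mem_piFinset.2 fun k => ?_, Finset.mem_univ _⟩
    have h := abs_midpoint_sub_lt he k
    rw [abs_lt] at h
    have hite : (0 : ℝ) ≤ (if k = e.2 then 1 / 2 else 0) ∧
        (if k = e.2 then 1 / 2 else 0 : ℝ) ≤ 1 / 2 := by
      split_ifs <;> norm_num
    have habs : |((e.1 k - i k : ℤ) : ℝ)| ≤ l / 2 + 1 / 2 := by
      push_cast
      exact abs_le.2 ⟨by linarith, by linarith⟩
    have hnat : (e.1 k - i k).natAbs ≤ m := by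
      refine Nat.le_floor ?_
      rwa [Nat.cast_natAbs, Int.cast_abs]
    rw [Finset.mem_Icc]
    omega
  have hcard : Fintype.card (edgesIn (box i l)) ≤ (2 * m + 1) ^ d * d := by
    have h1 := Finset.card_le_card_of_injOn (s := (Finset.univ : Finset (edgesIn (box i l))))
      (fun e => e.1) (fun e _ => hsub e.1 e.2) Subtype.val_injective.injOn
    have h2 : ∀ k, (Finset.Icc (i k - (m : ℤ)) (i k + m)).card = 2 * m + 1 := fun k => by
      rw [Int.card_Icc]
      omega
    simpa [Finset.card_product, Fintype.card_piFinset, h2] using h1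
  have hm3 : (2 * m + 1 : ℝ) ≤ 3 * l := by
    have := Nat.floor_le (show (0 : ℝ) ≤ l / 2 + 1 / 2 by linarith)
    rw [← hm] at this
    linarith
  calc (Fintype.card (edgesIn (box i l)) : ℝ) ≤ (2 * m + 1 : ℝ) ^ d * d := by exact_mod_cast hcard
    _ ≤ (3 * l) ^ d * d := by gcongr
    _ = d * 3 ^ d * l ^ d := by rw [mul_pow]; ring

end Box

section Wegner

theorem exists_Icc_of_ordConnected {I : Set ℝ} (hI : I.OrdConnected) (hne : I.Nonempty) {R : ℝ}
    (hR : I ⊆ Ioo (-R) R) :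
    ∃ a b, a ≤ b ∧ I ⊆ Icc a b ∧ b - a ≤ volume.real I := by
  have hbb : BddBelow I := ⟨-R, fun x hx => (hR hx).1.le⟩
  have hba : BddAbove I := ⟨R, fun x hx => (hR hx).2.le⟩
  have hle := csInf_le_csSup hne hbb hba
  refine ⟨sInf I, sSup I, hle, fun x hx => ⟨csInf_le hbb hx, le_csSup hba hx⟩, ?_⟩
  have hfin : volume I ≠ ⊤ := (measure_mono hR).trans_lt measure_Ioo_lt_top |>.ne
  have := measureReal_mono
    (IsConnected.Ioo_csInf_csSup_subset ⟨hne, hI.isPreconnected⟩ hbb hba) hfin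
  rwa [Real.volume_real_Ioo_of_le hle] at this

variable {ι : Type*} {μ : Measure ℝ} [IsProbabilityMeasure μ]

/-- An event that depends only on the coordinates in a finite set `s` has at most the probability
of its projection; `T` need not be measurable. -/
theorem infinitePi_real_restrict_le (s : Set ι) [Fintype s] (T : Set (s → ℝ)) :
    (Measure.infinitePi fun _ : ι => μ).real {ω | (fun e : s => ω e) ∈ T}
      ≤ (Measure.pi fun _ : s => μ).real T := by
  have h := Measure.infinitePi_map_restrict' (μ := fun _ : ι => μ) (I := s)
  rw [Measure.infinitePi_eq_pi (μ := fun _ : s => μ)] at h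
  rw [← h, measureReal_def, measureReal_def]
  refine ENNReal.toReal_mono (measure_ne_top _ _) ?_
  have hmeas : Measurable (s.domRestrict : (ι → ℝ) → s → ℝ) :=
    measurable_pi_lambda _ fun e => measurable_pi_apply (e : ι)
  exact Measure.le_map_apply hmeas.aemeasurable T

theorem ae_forall_le_of_support {qmin qmax : ℝ} (hsupp : μ.support = Icc qmin qmax) [Countable ι] :
    ∀ᵐ ω ∂(Measure.infinitePi fun _ : ι => μ), ∀ e, qmin ≤ ω e := by
  refine ae_all_iff.2 fun e => ?_
  have h : ∀ᵐ x ∂μ, qmin ≤ x := by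
    filter_upwards [Measure.support_mem_ae (μ := μ)] with x hx
    rw [hsupp] at hx
    exact hx.1
  exact (measurePreserving_eval_infinitePi (fun _ : ι => μ) e).quasiMeasurePreserving.ae h

/-- The Wegner estimate for a finite metric graph: at most `M c + 1` min-max levels can reach the
interval, and each does so with probability controlled by Stollmann's lemma. -/
theorem wegner_estimate_finite_graph [Countable ι] {V : Type*} (s : Set ι) [Fintype s]
    (src tgt : s → V) {qmin qmax : ℝ} (hsupp : μ.support = Icc qmin qmax) {K α : ℝ} (hα : 0 < α)
    (hμ : ∀ a b : ℝ, a ≤ b → μ.real (Icc a b) ≤ K * (b - a) ^ α) {R : ℝ} {M : ℕ} (hM : 0 < M)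
    (hMR : R ≤ M + qmin) {I : Set ℝ} (hI : I.OrdConnected) (hIR : I ⊆ Ioo (-R) R) :
    (Measure.infinitePi fun _ : ι => μ).real {ω | ∃ x ∈ I,
        (x : ℂ) ∈ unboundedSpectrum (graphSchrodinger src tgt fun e => ω e)}
      ≤ (M + 1) * Fintype.card s ^ 2 * (K * volume.real I ^ α) := by
  classical
  have hK0 : 0 ≤ K := by
    have := measureReal_nonneg.trans (hμ 0 1 zero_le_one)
    simpa using this
  rcases I.eq_empty_or_nonempty with rfl | hne
  · simp only [mem_empty_iff_false, false_and, exists_false, ofPred_false, measureReal_empty]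
    positivity
  obtain ⟨a, b, hab, hIab, hvol⟩ := exists_Icc_of_ordConnected hI hne hIR
  have hba : 0 ≤ b - a := sub_nonneg.2 hab
  set c := Fintype.card s with hc
  set T : ℕ → Set (s → ℝ) := fun n =>
    {q | (∃ W : Submodule ℂ (sobolevSpace src tgt), Module.finrank ℂ W = n + 1) ∧
      minMaxLevel src tgt n q ∈ Icc a b} with hT
  have hTle : ∀ n, (Measure.pi fun _ : s => μ).real (T n) ≤ c * (K * (b - a) ^ α) := by
    intro n
    by_cases hn : ∃ W : Submodule ℂ (sobolevSpace src tgt), Module.finrank ℂ W = n + 1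
    · simp only [hT, hn, true_and]
      exact pi_preimage_Icc_le (monotone_minMaxLevel hn) (minMaxLevel_shift hn) hα hμ hab
    · simp only [hT, hn, false_and, ofPred_false, measureReal_empty]
      positivity
  have hsub : ({ω | ∃ x ∈ I, (x : ℂ) ∈ unboundedSpectrum (graphSchrodinger src tgt fun e => ω e)}
        : Set (ι → ℝ))
      ≤ᵐ[Measure.infinitePi fun _ : ι => μ]
        ⋃ n ∈ Finset.range (M * c + 1), {ω | (fun e : s => ω e) ∈ T n} := by
    filter_upwards [ae_forall_le_of_support (ι := ι) hsupp] with ω hω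
    rintro ⟨x, hxI, hx⟩
    obtain ⟨u, hu0, hu⟩ := exists_eigenvector_of_mem_spectrum hx
    obtain ⟨n, hn, hW, hlev⟩ := exists_minMaxLevel_eq (fun e : s => hω e) hM
      ((hIR hxI).2.le.trans hMR) hu0 hu
    refine mem_iUnion₂.2 ⟨n, Finset.mem_range.2 (Nat.lt_succ_of_le hn), hW, ?_⟩
    rw [hlev]
    exact hIab hxI
  have hcc : ((M * c + 1 : ℕ) : ℝ) * c ≤ (M + 1) * c ^ 2 := by
    have : (M * c + 1) * c ≤ (M + 1) * c ^ 2 := by nlinarith [Nat.le_self_pow two_ne_zero c]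
    exact_mod_cast this
  calc _ ≤ (Measure.infinitePi fun _ : ι => μ).real
          (⋃ n ∈ Finset.range (M * c + 1), {ω | (fun e : s => ω e) ∈ T n}) :=
        ENNReal.toReal_mono (measure_ne_top _ _) (measure_mono_ae hsub)
    _ ≤ ∑ n ∈ Finset.range (M * c + 1), (Measure.infinitePi fun _ : ι => μ).real
          {ω | (fun e : s => ω e) ∈ T n} := measureReal_biUnion_finset_le _ _
    _ ≤ ∑ n ∈ Finset.range (M * c + 1), c * (K * (b - a) ^ α) :=
        Finset.sum_le_sum fun n _ => (infinitePi_real_restrict_le _ _).trans (hTle n)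
    _ = ((M * c + 1 : ℕ) * c) * (K * (b - a) ^ α) := by
        rw [Finset.sum_const, Finset.card_range, nsmul_eq_mul, mul_assoc]
    _ ≤ (M + 1) * c ^ 2 * (K * volume.real I ^ α) := by
        gcongr

end Wegner

theorem mainTheorem3 (d : ℕ) (hd : 1 ≤ d) (qmin qmax : ℝ)
    (μ : Measure ℝ) [IsProbabilityMeasure μ] (hsupp : μ.support = Icc qmin qmax)
    (α : ℝ) (hα : 0 < α) (hμ : IsHolderMeasure μ α) :
    ∀ R : ℝ, 0 < R → ∃ C : ℝ, ∀ (i : Fin d → ℤ) (l : ℝ), 0 < l → IsEdgeBounded (box i l) →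
      ∀ I : Set ℝ, I.OrdConnected → I ⊆ Ioo (-R) R →
        (Measure.infinitePi fun _ : LatticeEdge d => μ).real
            {ω | ∃ E ∈ I, (E : ℂ) ∈ unboundedSpectrum (neumannOperator i l ω)}
          ≤ C * volume.real (box i l) ^ 2 * volume.real I ^ α := by
  intro R _
  obtain ⟨K, hK⟩ := hμ
  have hK0 : 0 ≤ K := by
    have := measureReal_nonneg.trans (hK 0 1 zero_le_one)
    simpa using this
  -- With `M ≥ R - qmin` steps per edge, the form is at least `R ‖u‖²` on the orthogonal
  -- complement of the step functions.
  set M : ℕ := ⌈R - qmin⌉₊ + 1 with hM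
  have hMR : R ≤ M + qmin := by
    have := Nat.le_ceil (R - qmin)
    rw [hM]
    push_cast
    linarith
  refine ⟨(M + 1) * (d * 3 ^ d) ^ 2 * K, fun i l hl _ I hI hIR => ?_⟩
  refine (wegner_estimate_finite_graph (edgesIn (box i l)) (fun e => e.1.initial)
    (fun e => e.1.terminal) hsupp hα hK (Nat.succ_pos _) hMR hI hIR).trans ?_
  calc (M + 1) * (Fintype.card (edgesIn (box i l)) : ℝ) ^ 2 * (K * volume.real I ^ α)
      ≤ (M + 1) * (d * 3 ^ d * volume.real (box i l)) ^ 2 * (K * volume.real I ^ α) := by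
        gcongr
        exact card_edgesIn_box_le i hl
    _ = (M + 1) * (d * 3 ^ d) ^ 2 * K * volume.real (box i l) ^ 2 * volume.real I ^ α := by
        ring
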